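/- Let $L,\eta,\kappa,\beta,\tau>0$ and let $m,\delta,p\in W^{1,\infty}(0,L)$ be real functions, positive at every point of $[0,L]$. Consider the system $$m\,u_{tt}-(p\,u_x+2\delta\,u_{xt})_x+\eta\,\theta_x=0,\qquad \theta_t+\kappa\,q_x+\eta\,u_{xt}=0,\qquad \tau\,q_t+\beta\,q+\kappa\,\theta_x=0$$ on $(0,L)\times(0,\infty)$ with the boundary conditions $u=q=0$ at $x=0$ and $x=L$. On the complex space $\mathcal H=H^1_0(0,L)\times L^2(0,L)^3$ of states $U=(u,w,\theta,q)$ with the norm $$\|U\|_{\mathcal H}^2=\int_0^L p|u_x|^2+\int_0^L m|w|^2+\int_0^L|\theta|^2+\tau\int_0^L|q|^2,$$ let $$\mathcal A(u,w,\theta,q)=\Big(w,\ \tfrac1m\,(p\,u_x+2\delta\,w_x-\eta\,\theta)_x,\ -\kappa\,q_x-\eta\,w_x,\ -\tfrac1\tau(\kappa\,\theta_x+\beta\,q)\Big)$$ with domain $$\mathcal D_2=\{(u,w,\theta,q)\in\mathcal H:\ w\in H^1_0(0,L),\ p\,u_x+2\delta\,w_x\in H^1(0,L),\ \theta\in H^1(0,L),\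 q\in H^1_0(0,L)\}.$$ Then $\mathcal A$ is the generator of a strongly continuous semigroup of contractions $(T(t))_{t\ge0}$ on $\mathcal H$. The subspace $\mathcal H_0=\{U\in\mathcal H:\int_0^L\theta\,dx=0\}$ is invariant under $T(t)$, and the semigroup is exponentially stable there: there are constants $M,r>0$ such that $$\|T(t)U\|_{\mathcal H}\le M e^{-rt}\|U\|_{\mathcal H}\qquad(t\ge0,\ U\in\mathcal H_0).$$ Moreover, with the same constants, for every $U=(u,w,\theta,q)\in\mathcal H$ and $U_\infty=\big(0,0,\tfrac1L\int_0^L\theta\,dx,0\big)$, $$\|T(t)U-U_\infty\|_{\mathcal H}\le M e^{-rt}\|U-U_\infty\|_{\mathcal H}\qquad(t\ge0).$$ -/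

import Mathlib

open MeasureTheory Set Filter Topology
open scoped ContDiff NNReal ENNReal ComplexConjugate

namespace ThermoBeam

/-! ## Lebesgue and Sobolev spaces on the interval `(0, L)` -/

/-- The complex space `L²(0, L)`. -/
noncomputable abbrev L2 (L : ℝ) := Lp ℂ 2 (volume.restrict (Ioo 0 L))

/-- `g` is the weak derivative of `f` on `(0, L)`: `∫ φ' f = - ∫ φ g` for every test function
`φ ∈ C_c^∞(0, L)`. -/
def IsWeakDeriv {E : Type*} [NormedAddCommGroup E] [NormedSpace ℝ E] (L : ℝ) (f g : ℝ → E) :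
    Prop :=
  ∀ φ : ℝ → ℝ, ContDiff ℝ ∞ φ → HasCompactSupport φ → tsupport φ ⊆ Ioo 0 L →
    ∫ x in Ioo 0 L, deriv φ x • f x = - ∫ x in Ioo 0 L, φ x • g x

/-- `a ∈ W^{1,∞}(0, L)`, where `a` is the continuous representative on `[0, L]` of its class
(which is then automatically bounded). -/
def MemW1Inf (L : ℝ) (a : ℝ → ℝ) : Prop :=
  ContinuousOn a (Icc 0 L) ∧
    ∃ b : ℝ → ℝ, MemLp b ∞ (volume.restrict (Ioo 0 L)) ∧ IsWeakDeriv L a b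

theorem integrable_smul_of_continuous {L : ℝ} {φ : ℝ → ℝ} (hφ : Continuous φ) (f : L2 L) :
    Integrable (fun x => φ x • f x) (volume.restrict (Ioo 0 L)) := by
  have hf : Integrable f (volume.restrict (Ioo 0 L)) :=
    (Lp.memLp f).integrable (by norm_num)
  obtain ⟨C, hC⟩ := isCompact_Icc.exists_bound_of_continuousOn (hφ.continuousOn (s := Icc 0 L))
  refine hf.bdd_smul C hφ.aestronglyMeasurable ?_
  filter_upwards [ae_restrict_mem measurableSet_Ioo] with x hx
  exact hC x (Ioo_subset_Icc_self hx)

theorem IsWeakDeriv.add {L : ℝ} {f g f' g' : L2 L} (h : IsWeakDeriv L f g)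
    (h' : IsWeakDeriv L f' g') : IsWeakDeriv L (f + f' : L2 L) (g + g' : L2 L) := by
  intro φ h1 h2 h3
  have e1 : ∫ x in Ioo 0 L, deriv φ x • (f + f' : L2 L) x
      = ∫ x in Ioo 0 L, (deriv φ x • f x + deriv φ x • f' x) := by
    refine integral_congr_ae ?_
    filter_upwards [Lp.coeFn_add f f'] with x hx
    rw [hx, Pi.add_apply, smul_add]
  have e2 : ∫ x in Ioo 0 L, φ x • (g + g' : L2 L) x
      = ∫ x in Ioo 0 L, (φ x • g x + φ x • g' x) := by
    refine integral_congr_ae ?_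
    filter_upwards [Lp.coeFn_add g g'] with x hx
    rw [hx, Pi.add_apply, smul_add]
  have hd : Continuous (deriv φ) := h1.continuous_deriv (by simp)
  rw [e1, e2, integral_add (integrable_smul_of_continuous hd f)
    (integrable_smul_of_continuous hd f'), integral_add
    (integrable_smul_of_continuous h1.continuous g)
    (integrable_smul_of_continuous h1.continuous g'), h φ h1 h2 h3, h' φ h1 h2 h3]
  ring

theorem IsWeakDeriv.smul {L : ℝ} {f g : L2 L} (c : ℂ) (h : IsWeakDeriv L f g) :
    IsWeakDeriv L (c • f : L2 L) (c • g : L2 L) := by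
  intro φ h1 h2 h3
  have e1 : ∫ x in Ioo 0 L, deriv φ x • (c • f : L2 L) x
      = ∫ x in Ioo 0 L, c • (deriv φ x • f x) := by
    refine integral_congr_ae ?_
    filter_upwards [Lp.coeFn_smul c f] with x hx
    rw [hx, Pi.smul_apply, smul_comm]
  have e2 : ∫ x in Ioo 0 L, φ x • (c • g : L2 L) x
      = ∫ x in Ioo 0 L, c • (φ x • g x) := by
    refine integral_congr_ae ?_
    filter_upwards [Lp.coeFn_smul c g] with x hx
    rw [hx, Pi.smul_apply, smul_comm]
  rw [e1, e2, integral_smul, integral_smul, h φ h1 h2 h3, smul_neg]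

theorem isWeakDeriv_zero (L : ℝ) : IsWeakDeriv L (0 : L2 L) (0 : L2 L) := by
  simpa using (IsWeakDeriv.smul (L := L) (f := 0) (g := 0) 0) (fun φ _ _ _ => by
    have e (ψ : ℝ → ℝ) : ∫ x in Ioo 0 L, ψ x • (0 : L2 L) x = 0 := by
      rw [integral_congr_ae (g := fun _ => (0 : ℂ))]
      · simp
      · filter_upwards [Lp.coeFn_zero ℂ 2 (volume.restrict (Ioo 0 L))] with x hx
        rw [hx]; simp
    rw [e, e, neg_zero])

/-- Weak derivatives are unique. -/
theorem IsWeakDeriv.unique {L : ℝ} {f g g' : L2 L} (h : IsWeakDeriv L f g)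
    (h' : IsWeakDeriv L f g') : g = g' := by
  have key : IsWeakDeriv L (0 : L2 L) (g - g' : L2 L) := by
    have := h.add (h'.smul (-1))
    simpa [sub_eq_add_neg] using this
  have h0 : ∀ᵐ x ∂(volume : Measure ℝ), x ∈ Ioo 0 L → (g - g' : L2 L) x = 0 := by
    refine isOpen_Ioo.ae_eq_zero_of_integral_contDiff_smul_eq_zero ?_ ?_
    · have hi : IntegrableOn (g - g' : L2 L) (Ioo 0 L) :=
        (Lp.memLp (g - g')).integrable (by norm_num)
      exact hi.locallyIntegrableOn
    · intro φ h1 h2 h3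
      have hk := key φ h1 h2 h3
      have e : ∫ x in Ioo 0 L, deriv φ x • (0 : L2 L) x = 0 := by
        rw [integral_congr_ae (g := fun _ => (0 : ℂ))]
        · simp
        · filter_upwards [Lp.coeFn_zero ℂ 2 (volume.restrict (Ioo 0 L))] with x hx
          rw [hx]; simp
      rw [e, eq_comm, neg_eq_zero] at hk
      rw [← hk, eq_comm]
      refine setIntegral_eq_integral_of_forall_compl_eq_zero fun x hx => ?_
      rw [image_eq_zero_of_notMem_tsupport (fun hx' => hx (h3 hx')), zero_smul]
  rw [← sub_eq_zero]
  refine Lp.ext ?_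
  rw [← ae_restrict_iff' measurableSet_Ioo] at h0
  filter_upwards [h0, Lp.coeFn_zero ℂ 2 (volume.restrict (Ioo 0 L))] with x hx hx'
  rw [hx, hx', Pi.zero_apply]

/-- `H¹(0, L)`: the elements of `L²(0, L)` with a weak derivative in `L²(0, L)`. -/
def H1 (L : ℝ) : Submodule ℂ (L2 L) where
  carrier := {f | ∃ g : L2 L, IsWeakDeriv L f g}
  zero_mem' := ⟨0, isWeakDeriv_zero L⟩
  add_mem' := by
    rintro f f' ⟨g, h⟩ ⟨g', h'⟩
    exact ⟨g + g', h.add h'⟩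
  smul_mem' := by
    rintro c f ⟨g, h⟩
    exact ⟨c • g, h.smul c⟩

open Classical in
/-- The weak derivative `f_x ∈ L²(0, L)` of `f ∈ H¹(0, L)` (and `0` if `f ∉ H¹(0, L)`). -/
noncomputable def weakDeriv {L : ℝ} (f : L2 L) : L2 L :=
  if h : ∃ g : L2 L, IsWeakDeriv L f g then h.choose else 0

theorem isWeakDeriv_weakDeriv {L : ℝ} {f : L2 L} (hf : f ∈ H1 L) :
    IsWeakDeriv L f (weakDeriv f) := by
  have h : ∃ g : L2 L, IsWeakDeriv L f g := hf
  rw [weakDeriv, dif_pos h]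
  exact h.choose_spec

theorem weakDeriv_add {L : ℝ} {f g : L2 L} (hf : f ∈ H1 L) (hg : g ∈ H1 L) :
    weakDeriv (f + g) = weakDeriv f + weakDeriv g :=
  (isWeakDeriv_weakDeriv ((H1 L).add_mem hf hg)).unique
    ((isWeakDeriv_weakDeriv hf).add (isWeakDeriv_weakDeriv hg))

theorem weakDeriv_smul {L : ℝ} (c : ℂ) {f : L2 L} (hf : f ∈ H1 L) :
    weakDeriv (c • f) = c • weakDeriv f :=
  (isWeakDeriv_weakDeriv ((H1 L).smul_mem c hf)).unique ((isWeakDeriv_weakDeriv hf).smul c)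

/-- `H¹₀(0, L)`: the elements of `H¹(0, L)` whose continuous representative on `[0, L]`
vanishes at `0` and at `L`. -/
def H10 (L : ℝ) : Submodule ℂ (L2 L) where
  carrier := {f | f ∈ H1 L ∧ ∃ c : ℝ → ℂ, ContinuousOn c (Icc 0 L) ∧
    f =ᵐ[volume.restrict (Ioo 0 L)] c ∧ c 0 = 0 ∧ c L = 0}
  zero_mem' := ⟨(H1 L).zero_mem, 0, continuousOn_const, Lp.coeFn_zero _ _ _, rfl, rfl⟩
  add_mem' := by
    rintro f f' ⟨h, c, hc, hfc, h0, hL⟩ ⟨h', c', hc', hfc', h0', hL'⟩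
    refine ⟨(H1 L).add_mem h h', c + c', hc.add hc', ?_, by simp [h0, h0'], by simp [hL, hL']⟩
    exact (Lp.coeFn_add f f').trans (hfc.add hfc')
  smul_mem' := by
    rintro a f ⟨h, c, hc, hfc, h0, hL⟩
    refine ⟨(H1 L).smul_mem a h, a • c, hc.const_smul a, ?_, by simp [h0], by simp [hL]⟩
    exact (Lp.coeFn_smul a f).trans (hfc.const_smul a)

theorem H10_le_H1 (L : ℝ) : H10 L ≤ H1 L := fun _ hf => hf.1

/-- A continuous function on `ℝ` that vanishes off a compact `K ⊆ (0, L)` and has zero integral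
has a primitive that vanishes off a compact subset of `(0, L)`. -/
theorem exists_test_primitive {L : ℝ} {g : ℝ → ℝ} (hg : ContDiff ℝ ∞ g) {K : Set ℝ}
    (hK : IsCompact K) (hKne : K.Nonempty) (hKL : K ⊆ Ioo 0 L) (hgK : ∀ x, x ∉ K → g x = 0)
    (hint : ∫ x, g x = 0) :
    ∃ φ : ℝ → ℝ, ContDiff ℝ ∞ φ ∧ HasCompactSupport φ ∧ tsupport φ ⊆ Ioo 0 L ∧ deriv φ = g := by
  have ha := hKL (hK.sInf_mem hKne)
  have hb := hKL (hK.sSup_mem hKne)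
  have hsub : K ⊆ Icc (sInf K) (sSup K) := fun x hx =>
    ⟨csInf_le hK.bddBelow hx, le_csSup hK.bddAbove hx⟩
  have hd : ∀ x, HasDerivAt (fun x => ∫ y in (0 : ℝ)..x, g y) (g x) x := fun x =>
    intervalIntegral.integral_hasDerivAt_right (hg.continuous.intervalIntegrable _ _)
      (hg.continuous.stronglyMeasurableAtFilter _ _) hg.continuous.continuousAt
  have hderiv : deriv (fun x => ∫ y in (0 : ℝ)..x, g y) = g := funext fun x => (hd x).deriv
  have hsupp : tsupport (fun x => ∫ y in (0 : ℝ)..x, g y) ⊆ Icc (sInf K) (sSup K) := by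
    refine closure_minimal ?_ isClosed_Icc
    intro x hx
    by_contra hxn
    apply hx
    rw [mem_Icc, not_and_or, not_le, not_le] at hxn
    rcases hxn with h | h
    · refine (intervalIntegral.integral_congr (g := fun _ => 0) fun y hy => ?_).trans (by simp)
      refine hgK y fun hyK => ?_
      have h1 := (hsub hyK).1
      have h2 := hy.2
      rcases max_choice 0 x with hm | hm <;> rw [hm] at h2 <;> linarith [ha.1]
    · have hx0 : 0 ≤ x := by linarith [hb.1]
      show ∫ y in (0 : ℝ)..x, g y = 0
      rw [intervalIntegral.integral_of_le hx0]
      refine Eq.trans ?_ hint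
      refine setIntegral_eq_integral_of_forall_compl_eq_zero fun y hy => ?_
      refine hgK y fun hyK => hy ⟨(hKL hyK).1, ?_⟩
      linarith [(hsub hyK).2]
  refine ⟨_, ?_, ?_, ?_, hderiv⟩
  · rw [contDiff_infty_iff_deriv, hderiv]
    exact ⟨fun x => (hd x).differentiableAt, hg⟩
  · exact isCompact_Icc.of_isClosed_subset (isClosed_tsupport _) hsupp
  · exact hsupp.trans fun x hx => ⟨by linarith [ha.1, hx.1], by linarith [hb.2, hx.2]⟩

/-- The du Bois-Reymond lemma in `H¹₀(0, L)`: an element with zero weak derivative vanishes. -/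
theorem eq_zero_of_isWeakDeriv_zero {L : ℝ} (hL : 0 < L) {f : L2 L} (hf : f ∈ H10 L)
    (h : IsWeakDeriv L f (0 : L2 L)) : f = 0 := by
  let B : ContDiffBump (L / 2) := ⟨L / 8, L / 4, by positivity, by linarith⟩
  let ρ : ℝ → ℝ := B.normed volume
  have hρ : ContDiff ℝ ∞ ρ := B.contDiff_normed
  have hρs : tsupport ρ ⊆ Ioo 0 L := by
    rw [B.tsupport_normed_eq, Real.closedBall_eq_Icc]
    intro x hx
    have h1 : L / 2 - L / 4 ≤ x := hx.1
    have h2 : x ≤ L / 2 + L / 4 := hx.2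
    exact ⟨by linarith, by linarith⟩
  have hρc : HasCompactSupport ρ := B.hasCompactSupport_normed
  have hρi : ∫ x, ρ x = 1 := B.integral_normed
  have hρne : (tsupport ρ).Nonempty := by
    rw [B.tsupport_normed_eq]
    exact ⟨L / 2, Metric.mem_closedBall_self B.rOut_pos.le⟩
  set k : ℂ := ∫ x in Ioo 0 L, ρ x • f x with hk
  have hfi : Integrable f (volume.restrict (Ioo 0 L)) := (Lp.memLp f).integrable (by norm_num)
  have hconst : ∀ᵐ x ∂(volume : Measure ℝ), x ∈ Ioo 0 L → f x - k = 0 := by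
    refine isOpen_Ioo.ae_eq_zero_of_integral_contDiff_smul_eq_zero ?_ ?_
    · have hi : IntegrableOn (fun x => f x - k) (Ioo 0 L) := hfi.sub (integrable_const k)
      exact hi.locallyIntegrableOn
    · intro ψ h1 h2 h3
      have hψi : Integrable ψ := h1.continuous.integrable_of_hasCompactSupport h2
      have hρint : Integrable ρ := hρ.continuous.integrable_of_hasCompactSupport hρc
      obtain ⟨φ, hφ, hφc, hφs, hφd⟩ := exists_test_primitive (L := L)
        (g := fun x => ψ x - (∫ y, ψ y) * ρ x) (h1.sub (contDiff_const.mul hρ))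
        (IsCompact.union h2 hρc) (hρne.mono subset_union_right) (union_subset h3 hρs)
        (fun x hx => by
          rw [mem_union, not_or] at hx
          simp [image_eq_zero_of_notMem_tsupport hx.1, image_eq_zero_of_notMem_tsupport hx.2])
        (by rw [integral_sub hψi (hρint.const_mul _), integral_const_mul, hρi]; ring)
      have e := h φ hφ hφc hφs
      have e0 : ∫ x in Ioo 0 L, φ x • (0 : L2 L) x = 0 := by
        rw [integral_congr_ae (g := fun _ => (0 : ℂ))]
        · simp
        · filter_upwards [Lp.coeFn_zero ℂ 2 (volume.restrict (Ioo 0 L))] with x hx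
          rw [hx]; simp
      have e1 : ∫ x in Ioo 0 L, (ψ x - (∫ y, ψ y) * ρ x) • f x
          = (∫ x in Ioo 0 L, ψ x • f x) - (∫ y, ψ y) • k := by
        rw [hk, ← integral_smul]
        refine Eq.trans ?_ (integral_sub (integrable_smul_of_continuous h1.continuous f)
          ((integrable_smul_of_continuous hρ.continuous f).smul (∫ y, ψ y)))
        refine integral_congr_ae (Eventually.of_forall fun x => ?_)
        simp only [sub_smul, mul_smul]
      rw [hφd, e0, neg_zero, e1] at e
      have e2 : ∫ x in Ioo 0 L, ψ x = ∫ x, ψ x :=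
        setIntegral_eq_integral_of_forall_compl_eq_zero fun x hx =>
          image_eq_zero_of_notMem_tsupport (fun hx' => hx (h3 hx'))
      have e3 : ∫ x, ψ x • (f x - k) = ∫ x in Ioo 0 L, ψ x • (f x - k) := by
        refine (setIntegral_eq_integral_of_forall_compl_eq_zero fun x hx => ?_).symm
        rw [image_eq_zero_of_notMem_tsupport (fun hx' => hx (h3 hx')), zero_smul]
      rw [e3]
      simp only [smul_sub]
      rw [integral_sub (integrable_smul_of_continuous h1.continuous f)
        (hψi.integrableOn.smul_const k), integral_smul_const, e2]
      exact e
  obtain ⟨-, c, hc, hfc, hc0, -⟩ := hf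
  have hfk : f =ᵐ[volume.restrict (Ioo 0 L)] fun _ => k := by
    rw [← ae_restrict_iff' measurableSet_Ioo] at hconst
    filter_upwards [hconst] with x hx using sub_eq_zero.1 hx
  have hck : EqOn c (fun _ => k) (Icc 0 L) := by
    refine Measure.eqOn_Icc_of_ae_eq (μ := volume) hL.ne ?_ hc continuousOn_const
    rw [← restrict_Ioo_eq_restrict_Icc]
    exact hfc.symm.trans hfk
  have hk0 : k = 0 := (hck (left_mem_Icc.2 hL.le)).symm.trans hc0
  refine Lp.ext ?_
  filter_upwards [hfk, Lp.coeFn_zero ℂ 2 (volume.restrict (Ioo 0 L))] with x hx hx0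
  rw [hx, hx0, hk0, Pi.zero_apply]

theorem memLp_mul {L : ℝ} {a : ℝ → ℝ} (ha : ContinuousOn a (Icc 0 L)) (f : L2 L) :
    MemLp (fun x => (a x : ℂ) * f x) 2 (volume.restrict (Ioo 0 L)) := by
  obtain ⟨C, hC⟩ := isCompact_Icc.exists_bound_of_continuousOn ha
  have hm : AEStronglyMeasurable a (volume.restrict (Ioo 0 L)) :=
    (ha.mono Ioo_subset_Icc_self).aestronglyMeasurable measurableSet_Ioo
  refine (Lp.memLp f).of_le_mul (c := C)
    ((Complex.continuous_ofReal.comp_aestronglyMeasurable hm).mul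
      (Lp.memLp f).aestronglyMeasurable) ?_
  filter_upwards [ae_restrict_mem measurableSet_Ioo] with x hx
  rw [norm_mul, Complex.norm_real]
  exact mul_le_mul_of_nonneg_right (hC x (Ioo_subset_Icc_self hx)) (norm_nonneg _)

/-- Multiplication of elements of `L²(0, L)` by a real function continuous on `[0, L]`. -/
noncomputable def mulBy {L : ℝ} (a : ℝ → ℝ) (ha : ContinuousOn a (Icc 0 L)) :
    L2 L →ₗ[ℂ] L2 L where
  toFun := fun f => (memLp_mul ha f).toLp
  map_add' := fun f g => by
      rw [← MemLp.toLp_add]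
      refine MemLp.toLp_congr _ _ ?_
      filter_upwards [Lp.coeFn_add f g] with x hx
      simp only [hx, Pi.add_apply, mul_add]
  map_smul' := fun c f => by
      rw [RingHom.id_apply, ← MemLp.toLp_const_smul]
      refine MemLp.toLp_congr _ _ ?_
      filter_upwards [Lp.coeFn_smul c f] with x hx
      simp only [hx, Pi.smul_apply, smul_eq_mul]
      ring

theorem coeFn_mulBy {L : ℝ} (a : ℝ → ℝ) (ha : ContinuousOn a (Icc 0 L)) (f : L2 L) :
    mulBy a ha f =ᵐ[volume.restrict (Ioo 0 L)] fun x => (a x : ℂ) * f x :=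
  MemLp.coeFn_toLp (memLp_mul ha f)

/-! ## The system and its phase space -/

/-- The data of the system: the length `L` of the structure, the positive constants
`η, κ, β, τ`, and the coefficients `m, δ, p ∈ W^{1,∞}(0, L)`, positive on `[0, L]`. -/
structure Data where
  L : ℝ
  η : ℝ
  κ : ℝ
  β : ℝ
  τ : ℝ
  m : ℝ → ℝ
  δ : ℝ → ℝ
  p : ℝ → ℝ
  L_pos : 0 < L
  η_pos : 0 < η
  κ_pos : 0 < κ
  β_pos : 0 < β
  τ_pos : 0 < τ
  m_reg : MemW1Inf L m
  δ_reg : MemW1Inf L δ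
  p_reg : MemW1Inf L p
  m_pos : ∀ x ∈ Icc 0 L, 0 < m x
  δ_pos : ∀ x ∈ Icc 0 L, 0 < δ x
  p_pos : ∀ x ∈ Icc 0 L, 0 < p x

/-- The phase space `H¹₀(0, L) × L²(0, L) × L²(0, L) × L²(0, L)` of the states
`U = (u, w, θ, q)`; it carries the energy inner product defined below. -/
def Phase (S : Data) : Type := H10 S.L × L2 S.L × L2 S.L × L2 S.L

namespace Phase

variable {S : Data}

noncomputable instance : AddCommGroup (Phase S) :=
  inferInstanceAs (AddCommGroup (H10 S.L × L2 S.L × L2 S.L × L2 S.L))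

noncomputable instance : Module ℂ (Phase S) :=
  inferInstanceAs (Module ℂ (H10 S.L × L2 S.L × L2 S.L × L2 S.L))

/-- The displacement. -/
def u (U : Phase S) : H10 S.L := U.1

/-- The velocity. -/
def w (U : Phase S) : L2 S.L := U.2.1

/-- The temperature. -/
def θ (U : Phase S) : L2 S.L := U.2.2.1

/-- The heat flux. -/
def q (U : Phase S) : L2 S.L := U.2.2.2

/-- The state with the given components. -/
def mk (u : H10 S.L) (w θ q : L2 S.L) : Phase S := (u, w, θ, q)

@[simp] theorem add_u (U V : Phase S) : (U + V).u = U.u + V.u := rfl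
@[simp] theorem add_w (U V : Phase S) : (U + V).w = U.w + V.w := rfl
@[simp] theorem add_θ (U V : Phase S) : (U + V).θ = U.θ + V.θ := rfl
@[simp] theorem add_q (U V : Phase S) : (U + V).q = U.q + V.q := rfl
@[simp] theorem smul_u (c : ℂ) (U : Phase S) : (c • U).u = c • U.u := rfl
@[simp] theorem smul_w (c : ℂ) (U : Phase S) : (c • U).w = c • U.w := rfl
@[simp] theorem smul_θ (c : ℂ) (U : Phase S) : (c • U).θ = c • U.θ := rfl
@[simp] theorem smul_q (c : ℂ) (U : Phase S) : (c • U).q = c • U.q := rfl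
@[simp] theorem zero_u : (0 : Phase S).u = 0 := rfl
@[simp] theorem zero_w : (0 : Phase S).w = 0 := rfl
@[simp] theorem zero_θ : (0 : Phase S).θ = 0 := rfl
@[simp] theorem zero_q : (0 : Phase S).q = 0 := rfl
@[simp] theorem mk_u (u : H10 S.L) (w θ q : L2 S.L) : (mk u w θ q).u = u := rfl
@[simp] theorem mk_w (u : H10 S.L) (w θ q : L2 S.L) : (mk u w θ q).w = w := rfl
@[simp] theorem mk_θ (u : H10 S.L) (w θ q : L2 S.L) : (mk u w θ q).θ = θ := rfl
@[simp] theorem mk_q (u : H10 S.L) (w θ q : L2 S.L) : (mk u w θ q).q = q := rfl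

theorem ext' {U V : Phase S} (h1 : U.u = V.u) (h2 : U.w = V.w) (h3 : U.θ = V.θ)
    (h4 : U.q = V.q) : U = V :=
  Prod.ext h1 (Prod.ext h2 (Prod.ext h3 h4))

end Phase

/-- The energy inner product `∫ p u_x v_x + ∫ m w w' + ∫ θ θ' + τ ∫ q q'` (with complex
conjugates on the first argument, as usual in Mathlib). -/
noncomputable def energyInner (S : Data) (U V : Phase S) : ℂ :=
  (∫ x in Ioo 0 S.L,
      (S.p x : ℂ) * (conj (weakDeriv (U.u : L2 S.L) x) * weakDeriv (V.u : L2 S.L) x))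
    + (∫ x in Ioo 0 S.L, (S.m x : ℂ) * (conj (U.w x) * V.w x))
    + (∫ x in Ioo 0 S.L, conj (U.θ x) * V.θ x)
    + (S.τ : ℂ) * ∫ x in Ioo 0 S.L, conj (U.q x) * V.q x

theorem inner_mulBy {L : ℝ} (a : ℝ → ℝ) (ha : ContinuousOn a (Icc 0 L)) (f g : L2 L) :
    inner ℂ f (mulBy a ha g) = ∫ x in Ioo 0 L, (a x : ℂ) * (conj (f x) * g x) := by
  rw [L2.inner_def]
  refine integral_congr_ae ?_
  filter_upwards [coeFn_mulBy a ha g] with x hx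
  rw [hx, RCLike.inner_apply]
  ring

theorem inner_mulBy_symm {L : ℝ} (a : ℝ → ℝ) (ha : ContinuousOn a (Icc 0 L)) (f g : L2 L) :
    conj (inner ℂ g (mulBy a ha f)) = inner ℂ f (mulBy a ha g) := by
  rw [inner_mulBy, inner_mulBy, ← integral_conj]
  refine integral_congr_ae (Eventually.of_forall fun x => ?_)
  simp only [map_mul, Complex.conj_ofReal, Complex.conj_conj]
  ring

theorem inner_mulBy_self {L : ℝ} (a : ℝ → ℝ) (ha : ContinuousOn a (Icc 0 L)) (f : L2 L) :
    inner ℂ f (mulBy a ha f) = ((∫ x in Ioo 0 L, a x * ‖f x‖ ^ 2 : ℝ) : ℂ) := by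
  rw [inner_mulBy, ← integral_complex_ofReal]
  refine integral_congr_ae (Eventually.of_forall fun x => ?_)
  simp only [Complex.conj_mul', Complex.ofReal_mul, Complex.ofReal_pow]

theorem weighted_nonneg {L : ℝ} {a : ℝ → ℝ} (hp : ∀ x ∈ Icc 0 L, 0 < a x) (f : L2 L) :
    0 ≤ ∫ x in Ioo 0 L, a x * ‖f x‖ ^ 2 :=
  setIntegral_nonneg measurableSet_Ioo fun x hx =>
    mul_nonneg (hp x (Ioo_subset_Icc_self hx)).le (sq_nonneg _)

theorem eq_zero_of_weighted {L : ℝ} {a : ℝ → ℝ} (ha : ContinuousOn a (Icc 0 L))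
    (hp : ∀ x ∈ Icc 0 L, 0 < a x) {f : L2 L} (h : ∫ x in Ioo 0 L, a x * ‖f x‖ ^ 2 = 0) :
    f = 0 := by
  have hi : Integrable (fun x => a x * ‖f x‖ ^ 2) (volume.restrict (Ioo 0 L)) := by
    have h1 := (L2.integrable_inner (𝕜 := ℂ) f (mulBy a ha f)).re
    refine h1.congr ?_
    filter_upwards [coeFn_mulBy a ha f] with x hx
    have : inner ℂ (f x) ((a x : ℂ) * f x) = ((a x * ‖f x‖ ^ 2 : ℝ) : ℂ) := by
      rw [RCLike.inner_apply, mul_assoc, Complex.mul_conj']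
      push_cast
      rfl
    rw [hx, this]
    exact Complex.ofReal_re _
  have h0 := (integral_eq_zero_iff_of_nonneg_ae ?_ hi).1 h
  · refine Lp.ext ?_
    filter_upwards [h0, ae_restrict_mem measurableSet_Ioo,
      Lp.coeFn_zero ℂ 2 (volume.restrict (Ioo 0 L))] with x hx hxm hx0
    have := (hp x (Ioo_subset_Icc_self hxm)).ne'
    rw [hx0]
    simpa [this] using hx
  · filter_upwards [ae_restrict_mem measurableSet_Ioo] with x hx
    exact mul_nonneg (hp x (Ioo_subset_Icc_self hx)).le (sq_nonneg _)

theorem energyInner_eq (S : Data) (U V : Phase S) :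
    energyInner S U V =
      inner ℂ (weakDeriv (U.u : L2 S.L)) (mulBy S.p S.p_reg.1 (weakDeriv (V.u : L2 S.L)))
        + inner ℂ U.w (mulBy S.m S.m_reg.1 V.w) + inner ℂ U.θ V.θ
        + (S.τ : ℂ) * inner ℂ U.q V.q := by
  have e (f g : L2 S.L) : ∫ x in Ioo 0 S.L, conj (f x) * g x = inner ℂ f g := by
    rw [L2.inner_def]
    refine integral_congr_ae (Eventually.of_forall fun x => ?_)
    simp only [RCLike.inner_apply]
    ring
  rw [inner_mulBy, inner_mulBy, energyInner, e, e]

theorem energyInner_self (S : Data) (U : Phase S) :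
    energyInner S U U = (((∫ x in Ioo 0 S.L, S.p x * ‖weakDeriv (U.u : L2 S.L) x‖ ^ 2)
      + (∫ x in Ioo 0 S.L, S.m x * ‖U.w x‖ ^ 2) + ‖U.θ‖ ^ 2 + S.τ * ‖U.q‖ ^ 2 : ℝ) : ℂ) := by
  rw [energyInner_eq, inner_mulBy_self, inner_mulBy_self, inner_self_eq_norm_sq_to_K,
    inner_self_eq_norm_sq_to_K]
  push_cast
  rfl

/-- The energy inner product is a (positive definite) inner product. -/
noncomputable abbrev energyCore (S : Data) : InnerProductSpace.Core ℂ (Phase S) where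
  inner := energyInner S
  conj_inner_symm U V := by
    rw [energyInner_eq, energyInner_eq, map_add, map_add, map_add, map_mul, inner_mulBy_symm,
      inner_mulBy_symm, inner_conj_symm, inner_conj_symm, Complex.conj_ofReal]
  re_inner_nonneg U := by
    rw [energyInner_self, RCLike.re_eq_complex_re, Complex.ofReal_re]
    have h1 := weighted_nonneg S.p_pos (weakDeriv (U.u : L2 S.L))
    have h2 := weighted_nonneg S.m_pos U.w
    have h3 := S.τ_pos
    positivity
  add_left U V W := by
    simp only [energyInner_eq, Phase.add_u, Phase.add_w, Phase.add_θ, Phase.add_q,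
      Submodule.coe_add, inner_add_left,
      weakDeriv_add (H10_le_H1 _ U.u.2) (H10_le_H1 _ V.u.2)]
    ring
  smul_left U V c := by
    simp only [energyInner_eq, Phase.smul_u, Phase.smul_w, Phase.smul_θ, Phase.smul_q,
      Submodule.coe_smul, inner_smul_left, weakDeriv_smul c (H10_le_H1 _ U.u.2)]
    ring
  definite U h := by
    rw [energyInner_self, Complex.ofReal_eq_zero] at h
    have h1 := weighted_nonneg S.p_pos (weakDeriv (U.u : L2 S.L))
    have h2 := weighted_nonneg S.m_pos U.w
    have h3 : 0 ≤ ‖U.θ‖ ^ 2 := sq_nonneg _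
    have h4 : 0 ≤ S.τ * ‖U.q‖ ^ 2 := mul_nonneg S.τ_pos.le (sq_nonneg _)
    have e1 := eq_zero_of_weighted S.p_reg.1 S.p_pos (f := weakDeriv (U.u : L2 S.L))
      (by linarith)
    have e2 := eq_zero_of_weighted S.m_reg.1 S.m_pos (f := U.w) (by linarith)
    have e3 : ‖U.θ‖ ^ 2 = 0 := by linarith
    have e4 : S.τ * ‖U.q‖ ^ 2 = 0 := by linarith
    refine Phase.ext' (Subtype.ext ?_) e2 (by simpa using e3)
      (by simpa [S.τ_pos.ne'] using e4)
    refine eq_zero_of_isWeakDeriv_zero S.L_pos U.u.2 ?_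
    rw [← e1]
    exact isWeakDeriv_weakDeriv (H10_le_H1 _ U.u.2)

noncomputable instance (S : Data) : NormedAddCommGroup (Phase S) :=
  (energyCore S).toNormedAddCommGroup

noncomputable instance (S : Data) : InnerProductSpace ℂ (Phase S) :=
  InnerProductSpace.ofCore (energyCore S).toCore

/-! ## The operator of the system -/

theorem continuousOn_inv_m (S : Data) : ContinuousOn (fun x => (S.m x)⁻¹) (Icc 0 S.L) :=
  S.m_reg.1.inv₀ fun x hx => (S.m_pos x hx).ne'

/-- The viscoelastic stress `p u_x + 2 δ w_x`. -/
noncomputable def stress (S : Data) (U : Phase S) : L2 S.L :=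
  mulBy S.p S.p_reg.1 (weakDeriv (U.u : L2 S.L)) + (2 : ℂ) • mulBy S.δ S.δ_reg.1 (weakDeriv U.w)

theorem stress_add (S : Data) {U V : Phase S} (hU : U.w ∈ H10 S.L) (hV : V.w ∈ H10 S.L) :
    stress S (U + V) = stress S U + stress S V := by
  simp only [stress, Phase.add_u, Phase.add_w, Submodule.coe_add,
    weakDeriv_add (H10_le_H1 _ U.u.2) (H10_le_H1 _ V.u.2),
    weakDeriv_add (H10_le_H1 _ hU) (H10_le_H1 _ hV), map_add, smul_add]
  abel

theorem stress_smul (S : Data) (c : ℂ) {U : Phase S} (hU : U.w ∈ H10 S.L) :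
    stress S (c • U) = c • stress S U := by
  simp only [stress, Phase.smul_u, Phase.smul_w, Submodule.coe_smul,
    weakDeriv_smul c (H10_le_H1 _ U.u.2), weakDeriv_smul c (H10_le_H1 _ hU), map_smul, smul_add]
  rw [smul_comm]

/-- The domain, with clamped ends and zero heat flux at the ends: the `U = (u, w, θ, q)` in the
phase space with `w ∈ H¹₀`, `p u_x + 2 δ w_x ∈ H¹`, `θ ∈ H¹` and `q ∈ H¹₀`. -/
noncomputable def operatorDomain (S : Data) : Submodule ℂ (Phase S) where
  carrier := {U | U.w ∈ H10 S.L ∧ stress S U ∈ H1 S.L ∧ U.θ ∈ H1 S.L ∧ U.q ∈ H10 S.L}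
  zero_mem' := by
    have h : stress S 0 = 0 := by
      have := stress_smul S 0 (U := 0) (H10 S.L).zero_mem
      simpa using this
    refine ⟨(H10 S.L).zero_mem, ?_, (H1 S.L).zero_mem, (H10 S.L).zero_mem⟩
    rw [h]
    exact (H1 S.L).zero_mem
  add_mem' := by
    rintro U V ⟨h1, h2, h3, h4⟩ ⟨k1, k2, k3, k4⟩
    refine ⟨(H10 S.L).add_mem h1 k1, ?_, (H1 S.L).add_mem h3 k3, (H10 S.L).add_mem h4 k4⟩
    rw [stress_add S h1 k1]
    exact (H1 S.L).add_mem h2 k2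
  smul_mem' := by
    rintro c U ⟨h1, h2, h3, h4⟩
    refine ⟨(H10 S.L).smul_mem c h1, ?_, (H1 S.L).smul_mem c h3, (H10 S.L).smul_mem c h4⟩
    rw [stress_smul S c h1]
    exact (H1 S.L).smul_mem c h2

/-- The operator of the system, with domain `operatorDomain S`:
`(u, w, θ, q) ↦ (w, m⁻¹ (p u_x + 2 δ w_x - η θ)_x, -κ q_x - η w_x, -τ⁻¹ (κ θ_x + β q))`. -/
noncomputable def operator (S : Data) : Phase S →ₗ.[ℂ] Phase S where
  domain := operatorDomain S
  toFun :=
    { toFun := fun U => Phase.mk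
        ⟨U.1.w, U.2.1⟩
        (mulBy (fun x => (S.m x)⁻¹) (continuousOn_inv_m S)
          (weakDeriv (stress S U.1 - (S.η : ℂ) • U.1.θ)))
        (-((S.κ : ℂ) • weakDeriv U.1.q) - (S.η : ℂ) • weakDeriv U.1.w)
        (-((S.τ : ℂ)⁻¹ • ((S.κ : ℂ) • weakDeriv U.1.θ + (S.β : ℂ) • U.1.q)))
      map_add' := by
        rintro ⟨U, h1, h2, h3, h4⟩ ⟨V, k1, k2, k3, k4⟩
        have e : stress S (U + V) - (S.η : ℂ) • (U.θ + V.θ)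
            = (stress S U - (S.η : ℂ) • U.θ) + (stress S V - (S.η : ℂ) • V.θ) := by
          rw [stress_add S h1 k1, smul_add]
          abel
        refine Phase.ext' (Subtype.ext rfl) ?_ ?_ ?_
        · simp only [Phase.mk_w, Phase.add_w, Submodule.coe_add, Phase.add_θ]
          rw [e, weakDeriv_add ((H1 _).sub_mem h2 ((H1 _).smul_mem _ h3))
            ((H1 _).sub_mem k2 ((H1 _).smul_mem _ k3)), map_add]
        · simp only [Phase.mk_θ, Phase.add_w, Submodule.coe_add, Phase.add_θ, Phase.add_q]
          rw [weakDeriv_add h4.1 k4.1, weakDeriv_add h1.1 k1.1, smul_add, smul_add]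
          abel
        · simp only [Phase.mk_q, Submodule.coe_add, Phase.add_θ, Phase.add_q]
          rw [weakDeriv_add h3 k3]
          simp only [smul_add]
          abel
      map_smul' := by
        rintro c ⟨U, h1, h2, h3, h4⟩
        have e : stress S (c • U) - (S.η : ℂ) • (c • U.θ)
            = c • (stress S U - (S.η : ℂ) • U.θ) := by
          rw [stress_smul S c h1, smul_sub, smul_comm c (S.η : ℂ)]
        refine Phase.ext' (Subtype.ext rfl) ?_ ?_ ?_
        · simp only [Phase.mk_w, Phase.smul_w, Submodule.coe_smul, Phase.smul_θ,
            RingHom.id_apply]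
          rw [e, weakDeriv_smul c ((H1 _).sub_mem h2 ((H1 _).smul_mem _ h3)), map_smul]
        · simp only [Phase.mk_θ, Phase.smul_w, Submodule.coe_smul, Phase.smul_θ, Phase.smul_q,
            RingHom.id_apply]
          rw [weakDeriv_smul c h4.1, weakDeriv_smul c h1.1]
          module
        · simp only [Phase.mk_q, Submodule.coe_smul, Phase.smul_θ, Phase.smul_q,
            RingHom.id_apply]
          rw [weakDeriv_smul c h3]
          module }

/-- The states whose temperature has zero mean. -/
def HasZeroMean {S : Data} (U : Phase S) : Prop := ∫ x in Ioo 0 S.L, U.θ x = 0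

/-- The rest state `(0, 0, c, 0)`, where `c` is the mean of the temperature of `U`. -/
noncomputable def meanState {S : Data} (U : Phase S) : Phase S :=
  Phase.mk 0 0
    (Lp.const 2 (volume.restrict (Ioo 0 S.L)) ((S.L : ℂ)⁻¹ * ∫ x in Ioo 0 S.L, U.θ x)) 0

end ThermoBeam

/-! ## Strongly continuous semigroups -/

/-- A strongly continuous one-parameter semigroup of bounded operators. -/
structure C0Semigroup (X : Type*) [NormedAddCommGroup X] [NormedSpace ℂ X] where
  toFun : ℝ≥0 → X →L[ℂ] X
  map_zero : toFun 0 = ContinuousLinearMap.id ℂ X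
  map_add : ∀ s t, toFun (s + t) = (toFun s).comp (toFun t)
  tendsto_zero : ∀ x, Tendsto (fun t => toFun t x) (𝓝 0) (𝓝 x)

namespace C0Semigroup

variable {X : Type*} [NormedAddCommGroup X] [NormedSpace ℂ X]

/-- `A` is the infinitesimal generator of `T`: its domain consists of the `x` for which
`(T(t) x - x) / t` converges as `t → 0⁺`, and `A x` is the limit. -/
def IsGenerator (T : C0Semigroup X) (A : X →ₗ.[ℂ] X) : Prop :=
  ∀ x y : X, (x, y) ∈ A.graph ↔
    Tendsto (fun t : ℝ≥0 => ((t : ℝ) : ℂ)⁻¹ • (T.toFun t x - x)) (𝓝[>] 0) (𝓝 y)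

/-- `T` is a semigroup of contractions. -/
def IsContraction (T : C0Semigroup X) : Prop := ∀ t, ‖T.toFun t‖ ≤ 1

end C0Semigroup

/-! The energy identity is `Re ⟨U, AU⟩ = -2 ∫ δ |w_x|² - β ‖q‖²` (`re_inner_operator`). Hence `A` is
dissipative, and once `l - A` is shown to be onto for every `l > 0` (`operator_surjective`), the
Lumer–Phillips theorem (`IsMDissipative.exists_semigroup`, by Yosida approximation) gives the
contraction semigroup. In the resolvent equation `u` and `θ` are eliminated algebraically; what
remains is a coercive problem for `a = w_x` and `b = q_x`, solved by Lax–Milgram.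

The dissipation controls `w_x`, hence `w`, and `q`, but neither `u_x` nor `θ`. Two multipliers
recover these. The momentum equation tested with `u` produces `-∫ p |u_x|²`. The heat flux equation
tested with `∫₀ˣ θ` produces, with the right sign, `-κ ‖θ‖²`; its boundary term vanishes exactly
when `θ` has zero mean. So, for small `ε, M > 0`, the functional `‖U‖² + ε Re ⟨m w, u⟩ - M Re ⟨τ q,
∫₀ˣ θ⟩` is equivalent to `‖U‖²` and decays exponentially along zero-mean orbits (`exists_lyapunov`,
`IsGenerator.decay`). The only delicate term is the coupling `η θ u_x`, which is absorbed by fixing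
the ratio `ε / M` (`exists_lyapunov_weights`).

The integral of `θ` is conserved and constant temperatures are equilibria, so subtracting the mean
state reduces arbitrary data to zero-mean data; density of the domain removes the regularity
assumption.

All Sobolev arguments go through the Volterra operator `V f = ∫₀ˣ f` on `L²`: it maps the mean-zero
functions bijectively onto `H¹₀`, and integration by parts is the formula for its adjoint. -/

/-! ## Generation of contraction semigroups in Hilbert space -/

namespace DissipativeSemigroup

/-! ### Exponentials of bounded dissipative operators. -/

section Bounded

variable {H : Type*} [NormedAddCommGroup H] [InnerProductSpace ℂ H] [CompleteSpace H]

/-- The norm-continuous group generated by a bounded operator. -/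
noncomputable def expGroup (Y : H →L[ℂ] H) (t : ℝ) : H →L[ℂ] H := NormedSpace.exp (t • Y)

theorem expGroup_zero (Y : H →L[ℂ] H) : expGroup Y 0 = 1 := by
  simp [expGroup, NormedSpace.exp_zero]

theorem expGroup_add (Y : H →L[ℂ] H) (s t : ℝ) :
    expGroup Y (s + t) = expGroup Y s * expGroup Y t := by
  rw [expGroup, add_smul]
  let : NormedAlgebra ℚ (H →L[ℂ] H) := NormedAlgebra.restrictScalars ℚ ℂ (H →L[ℂ] H)
  exact NormedSpace.exp_add_of_commute (((Commute.refl Y).smul_left s).smul_right t)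

theorem hasDerivAt_expGroup (Y : H →L[ℂ] H) (t : ℝ) :
    HasDerivAt (expGroup Y) (expGroup Y t * Y) t :=
  hasDerivAt_exp_smul_const (𝕂 := ℝ) Y t

theorem commute_expGroup {Y Z : H →L[ℂ] H} (h : Commute Y Z) (t : ℝ) :
    Commute (expGroup Y t) Z :=
  (h.smul_left t).exp_left

theorem hasDerivAt_expGroup_apply (Y : H →L[ℂ] H) (x : H) (t : ℝ) :
    HasDerivAt (fun t => expGroup Y t x) (expGroup Y t (Y x)) t := by
  have h := (hasDerivAt_expGroup Y t)
  exact ((ContinuousLinearMap.apply ℂ H x).restrictScalars ℝ).hasFDerivAt.comp_hasDerivAt t h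

theorem hasDerivAt_norm_sq {E : Type*} [NormedAddCommGroup E] [InnerProductSpace ℂ E]
    {f : ℝ → E} {f' : E} {s : Set ℝ} {t : ℝ} (h : HasDerivWithinAt f f' s t) :
    HasDerivWithinAt (fun t => ‖f t‖ ^ 2) (2 * (inner ℂ (f t) f').re) s t := by
  let : InnerProductSpace ℝ E := InnerProductSpace.rclikeToReal ℂ E
  exact h.norm_sq

variable {Y Z : H →L[ℂ] H}

/-- The derivative of `‖e^{sY} x‖²` is `2 Re ⟨z, Y z⟩ ≤ 0` with `z = e^{sY} x`. -/
theorem norm_expGroup_apply_le (hY : ∀ x, (inner ℂ x (Y x)).re ≤ 0) {t : ℝ} (ht : 0 ≤ t) (x : H) :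
    ‖expGroup Y t x‖ ≤ ‖x‖ := by
  have hd : ∀ s, HasDerivAt (fun s => ‖expGroup Y s x‖ ^ 2)
      (2 * (inner ℂ (expGroup Y s x) (expGroup Y s (Y x))).re) s := fun s => by
    have := (hasDerivAt_expGroup_apply Y x s).hasDerivWithinAt (s := univ)
    simpa using hasDerivAt_norm_sq this
  have hanti : Antitone (fun s => ‖expGroup Y s x‖ ^ 2) := by
    refine antitone_of_deriv_nonpos (fun s => (hd s).differentiableAt) fun s => ?_
    rw [(hd s).deriv]
    have hc : expGroup Y s (Y x) = Y (expGroup Y s x) :=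
      DFunLike.congr_fun (commute_expGroup (Commute.refl Y) s).eq x
    rw [hc]
    linarith [hY (expGroup Y s x)]
  have := hanti ht
  simp only [expGroup_zero, one_apply_eq_self] at this
  exact (pow_le_pow_iff_left₀ (norm_nonneg _) (norm_nonneg _) two_ne_zero).1 this

/-- The path `s ↦ e^{sY} e^{(t-s)Z} x` joins the two vectors, and by commutation its velocity is a
product of contractions applied to `Y x - Z x`. -/
theorem norm_expGroup_sub_le (hY : ∀ x, (inner ℂ x (Y x)).re ≤ 0)
    (hZ : ∀ x, (inner ℂ x (Z x)).re ≤ 0) (hc : Commute Y Z) {t : ℝ} (ht : 0 ≤ t) (x : H) :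
    ‖expGroup Y t x - expGroup Z t x‖ ≤ t * ‖Y x - Z x‖ := by
  have hd : ∀ s, HasDerivAt (fun s => (expGroup Y s * expGroup Z (t - s)) x)
      (expGroup Y s (expGroup Z (t - s) (Y x - Z x))) s := fun s => by
    have h1 := (hasDerivAt_expGroup Y s).mul
      ((hasDerivAt_expGroup Z (t - s)).scomp s ((hasDerivAt_id s).const_sub t))
    have h2 := ((ContinuousLinearMap.apply ℂ H x).restrictScalars ℝ).hasFDerivAt.comp_hasDerivAt s h1
    have e : Y (expGroup Z (t - s) x) = expGroup Z (t - s) (Y x) :=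
      (DFunLike.congr_fun (commute_expGroup hc.symm (t - s)).eq x).symm
    refine h2.congr_deriv ?_
    simp only [ContinuousLinearMap.coe_restrictScalars', ContinuousLinearMap.apply_apply,
      add_apply, mul_apply_eq_comp, Function.comp_apply, neg_smul, one_smul, mul_neg,
      neg_apply, e, map_sub]
    abel
  have := norm_image_sub_le_of_norm_deriv_le_segment' (C := ‖Y x - Z x‖)
    (fun s (_ : s ∈ Icc 0 t) => (hd s).hasDerivWithinAt) (fun s hs =>
      (norm_expGroup_apply_le hY hs.1 _).trans (norm_expGroup_apply_le hZ (by linarith [hs.2]) _))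
    t ⟨ht, le_rfl⟩
  simpa [expGroup_zero, mul_comm] using this

theorem norm_expGroup_apply_sub_le (hY : ∀ x, (inner ℂ x (Y x)).re ≤ 0) {t : ℝ} (ht : 0 ≤ t)
    (x : H) : ‖expGroup Y t x - x‖ ≤ t * ‖Y x‖ := by
  have := norm_image_sub_le_of_norm_deriv_le_segment' (C := ‖Y x‖)
    (fun s (_ : s ∈ Icc 0 t) => (hasDerivAt_expGroup_apply Y x s).hasDerivWithinAt)
    (fun s hs => norm_expGroup_apply_le hY hs.1 _) t ⟨ht, le_rfl⟩
  simpa [expGroup_zero, mul_comm] using this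

/-- A first-order Taylor bound free of `Y² x`: the vector `Y x` is replaced by a nearby `z`, so that
only `Y z` enters. In the Yosida limit `z` can be taken in the domain close to `A x`, and the bound
stays uniform. -/
theorem norm_expGroup_remainder_le (hY : ∀ x, (inner ℂ x (Y x)).re ≤ 0) {t : ℝ} (ht : 0 ≤ t)
    (x z : H) :
    ‖expGroup Y t x - x - (t : ℂ) • Y x‖ ≤ t * (t * ‖Y z‖ + 2 * ‖Y x - z‖) := by
  have hd : ∀ s, HasDerivAt (fun s : ℝ => expGroup Y s x - s • Y x)
      (expGroup Y s (Y x) - Y x) s := fun s => by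
    have := (hasDerivAt_expGroup_apply Y x s).sub ((hasDerivAt_id s).smul_const (Y x))
    simpa using! this
  have := norm_image_sub_le_of_norm_deriv_le_segment' (C := t * ‖Y z‖ + 2 * ‖Y x - z‖)
    (fun s (_ : s ∈ Icc 0 t) => (hd s).hasDerivWithinAt) (fun s hs => ?_) t ⟨ht, le_rfl⟩
  · rw [sub_sub, add_comm, ← sub_sub]
    simpa [expGroup_zero, mul_comm] using this
  · have e : expGroup Y s (Y x) - Y x
        = (expGroup Y s z - z) + (expGroup Y s (Y x - z) - (Y x - z)) := by
      rw [map_sub]; abel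
    have h1 := norm_expGroup_apply_sub_le hY hs.1 z
    have h2 := norm_expGroup_apply_le hY hs.1 (Y x - z)
    have h3 : s * ‖Y z‖ ≤ t * ‖Y z‖ := by gcongr; exact hs.2.le
    rw [e]
    linarith [norm_add_le (expGroup Y s z - z) (expGroup Y s (Y x - z) - (Y x - z)),
      norm_sub_le (expGroup Y s (Y x - z)) (Y x - z)]

end Bounded

/-! ### Resolvents and Yosida approximations. -/

section Resolvent

variable {H : Type*} [NormedAddCommGroup H] [InnerProductSpace ℂ H]

/-- `A` is dissipative and `l - A` is onto for every `l > 0`. -/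
structure IsMDissipative (A : H →ₗ.[ℂ] H) : Prop where
  dissipative : ∀ x : A.domain, (inner ℂ (x : H) (A x)).re ≤ 0
  surjective : ∀ l : ℝ, 0 < l → ∀ y, ∃ x : A.domain, (l : ℂ) • (x : H) - A x = y

variable {A : H →ₗ.[ℂ] H}

/-- By dissipativity and Cauchy–Schwarz, `l ‖x‖² ≤ Re ⟨x, (l - A) x⟩ ≤ ‖x‖ ‖(l - A) x‖`. -/
theorem IsMDissipative.norm_le (hA : IsMDissipative A) (l : ℝ) (x : A.domain) :
    l * ‖(x : H)‖ ≤ ‖(l : ℂ) • (x : H) - A x‖ := by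
  rcases (norm_nonneg (x : H)).eq_or_lt with h | h
  · rw [← h, mul_zero]; exact norm_nonneg _
  · have h1 : (inner ℂ (x : H) ((l : ℂ) • (x : H) - A x)).re
        = l * ‖(x : H)‖ ^ 2 - (inner ℂ (x : H) (A x)).re := by
      rw [inner_sub_right, inner_smul_right, inner_self_eq_norm_sq_to_K]
      have : ((l : ℂ) * ((‖(x : H)‖ : ℂ)) ^ 2) = ((l * ‖(x : H)‖ ^ 2 : ℝ) : ℂ) := by push_cast; rfl
      rw [Complex.sub_re]
      congr 1
      exact (congrArg Complex.re this).trans (Complex.ofReal_re _)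
    have h2 := (Complex.re_le_norm _).trans (norm_inner_le_norm (𝕜 := ℂ) (x : H)
      ((l : ℂ) • (x : H) - A x))
    have h3 := hA.dissipative x
    refine le_of_mul_le_mul_left ?_ h
    nlinarith

theorem IsMDissipative.injective (hA : IsMDissipative A) {l : ℝ} (hl : 0 < l) {x y : A.domain}
    (h : (l : ℂ) • (x : H) - A x = (l : ℂ) • (y : H) - A y) : x = y := by
  have := hA.norm_le l (x - y)
  rw [LinearPMap.map_sub, Submodule.coe_sub, smul_sub,
    show (l : ℂ) • (x : H) - (l : ℂ) • (y : H) - (A x - A y)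
      = ((l : ℂ) • (x : H) - A x) - ((l : ℂ) • (y : H) - A y) by abel, h, sub_self, norm_zero] at this
  have h0 : ‖(x : H) - y‖ ≤ 0 := by
    by_contra hn
    push Not at hn
    nlinarith
  exact Subtype.ext (sub_eq_zero.1 (norm_le_zero_iff.1 h0))

/-- The contraction `l (l - A)⁻¹`. -/
theorem IsMDissipative.exists_resolvent (hA : IsMDissipative A) {l : ℝ} (hl : 0 < l) :
    ∃ J : H →L[ℂ] H, (∀ x, ‖J x‖ ≤ ‖x‖) ∧ ∀ y, ∃ h : J y ∈ A.domain,
      (l : ℂ) • J y - A ⟨J y, h⟩ = (l : ℂ) • y := by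
  choose R hR using fun y => hA.surjective l hl ((l : ℂ) • y)
  let J : H →ₗ[ℂ] H :=
    { toFun := fun y => R y
      map_add' := fun y z => by
        have : R (y + z) = R y + R z := hA.injective hl (by
          rw [hR, LinearPMap.map_add, Submodule.coe_add, smul_add, smul_add, add_sub_add_comm, hR, hR])
        rw [this]; rfl
      map_smul' := fun c y => by
        have : R (c • y) = c • R y := hA.injective hl (by
          rw [hR, LinearPMap.map_smul, Submodule.coe_smul, smul_comm (l : ℂ) c (R y : H),
            ← smul_sub, hR, smul_comm])
        rw [this]; rfl }
  have hJ : ∀ y, ‖J y‖ ≤ 1 * ‖y‖ := fun y => by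
    have h := hA.norm_le l (R y)
    rw [hR, norm_smul, Complex.norm_real, Real.norm_of_nonneg hl.le] at h
    rw [one_mul]
    exact le_of_mul_le_mul_left h hl
  exact ⟨J.mkContinuous 1 hJ, fun x => by simpa using hJ x, fun y => ⟨(R y).2, hR y⟩⟩

/-- If `x` is orthogonal to the domain and `y - A y = x`, then `0 = Re ⟨y, x⟩ ≥ ‖y‖²`, so `y = 0`
and `x = 0`. -/
theorem IsMDissipative.dense [CompleteSpace H] (hA : IsMDissipative A) : Dense (A.domain : Set H) := by
  rw [Submodule.dense_iff_topologicalClosure_eq_top, Submodule.topologicalClosure_eq_top_iff,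
    Submodule.eq_bot_iff]
  intro x hx
  obtain ⟨y, hy⟩ := hA.surjective 1 one_pos x
  have h0 := (Submodule.mem_orthogonal _ _).1 hx y y.2
  have h1 := hA.dissipative y
  have h2 : (inner ℂ (y : H) x).re = ‖(y : H)‖ ^ 2 - (inner ℂ (y : H) (A y)).re := by
    rw [← hy, Complex.ofReal_one, one_smul, inner_sub_right, Complex.sub_re, inner_self_eq_norm_sq_to_K]
    congr 1
    exact_mod_cast Complex.ofReal_re _
  rw [h0, Complex.zero_re] at h2
  have h3 : (y : H) = 0 := norm_eq_zero.1 (pow_eq_zero_iff two_ne_zero |>.1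
    (le_antisymm (by linarith) (sq_nonneg _)))
  have h4 : y = 0 := Subtype.ext h3
  rw [← hy, h4, LinearPMap.map_zero]
  simp

/-- The Yosida approximations. -/
theorem IsMDissipative.exists_yosida [CompleteSpace H] (hA : IsMDissipative A) :
    ∃ Y : ℕ → H →L[ℂ] H, (∀ n x, (inner ℂ x (Y n x)).re ≤ 0) ∧ (∀ m n, Commute (Y m) (Y n)) ∧
      (∀ n (x : A.domain), ‖Y n x‖ ≤ ‖A x‖) ∧
      ∀ x : A.domain, Tendsto (fun n => Y n x) atTop (𝓝 (A x)) := by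
  have hpos : ∀ n : ℕ, (0 : ℝ) < n + 1 := fun n => by positivity
  choose J hJ1 hJd hJ using fun n : ℕ => hA.exists_resolvent (hpos n)
  set l : ℕ → ℂ := fun n => (((n : ℝ) + 1 : ℝ) : ℂ) with hl
  have hl0 : ∀ n, l n ≠ 0 := fun n => Complex.ofReal_ne_zero.2 (hpos n).ne'
  have hinv : ∀ n (x : A.domain) (y : H), l n • (x : H) - A x = l n • y → J n y = x := by
    intro n x y h
    exact congrArg Subtype.val (hA.injective (x := ⟨J n y, hJd n y⟩) (hpos n) ((hJ n y).trans h.symm))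
  -- `J n` commutes with `A` on the domain, by uniqueness for the resolvent equation; the same
  -- uniqueness makes the `J n` commute with each other.
  have hAJ : ∀ n (x : A.domain), A ⟨J n x, hJd n x⟩ = J n (A x) := by
    intro n x
    have h1 := hinv n x ((x : H) - (l n)⁻¹ • A x) (by
      rw [smul_sub, smul_inv_smul₀ (hl0 n)])
    have h2 : A ⟨J n x, hJd n x⟩ = l n • (J n x - (x : H)) := by
      rw [smul_sub, ← hJ n x, sub_sub_cancel]
    rw [h2, ← sub_eq_zero]
    rw [map_sub, map_smul] at h1
    nth_rewrite 2 [← h1]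
    rw [sub_sub_cancel, smul_inv_smul₀ (hl0 n), sub_self]
  have hcomm : ∀ m n, Commute (J m) (J n) := by
    intro m n
    refine ContinuousLinearMap.ext fun y => ?_
    have h := hinv n ⟨J m (J n y), hJd m _⟩ (J m y) (by
      have := hAJ m ⟨J n y, hJd n y⟩
      rw [this, ← map_smul, ← map_sub, hJ n y, map_smul])
    exact h.symm
  -- The approximation `l (J - 1)` equals `J A` on the domain. Its bound by `‖A x‖` and its
  -- convergence to `A x` therefore reduce to `J n` being contractions that tend strongly to the
  -- identity.
  have hY : ∀ n (x : A.domain), (l n • (J n - 1)) x = J n (A x) := by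
    intro n x
    rw [← hAJ n x, smul_apply, sub_apply,
      one_apply_eq_self, smul_sub, ← hJ n x, sub_sub_cancel]
  have hJlim : ∀ x, Tendsto (fun n => J n x) atTop (𝓝 x) := by
    intro x
    rw [Metric.tendsto_atTop]
    intro ε hε
    obtain ⟨z, hz, hxz⟩ := hA.dense.exists_dist_lt x (show 0 < ε / 3 by positivity)
    obtain ⟨N, hN⟩ := exists_nat_gt (‖A ⟨z, hz⟩‖ / (ε / 3))
    refine ⟨N, fun n hn => ?_⟩
    have h1 : ‖J n z - z‖ < ε / 3 := by
      have h2 : J n z - z = (l n)⁻¹ • J n (A ⟨z, hz⟩) := by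
        rw [← hY n ⟨z, hz⟩, smul_apply, inv_smul_smul₀ (hl0 n),
          sub_apply, one_apply_eq_self]
      rw [h2, norm_smul, norm_inv, hl, Complex.norm_real, Real.norm_of_nonneg (hpos n).le,
        inv_mul_lt_iff₀ (hpos n)]
      refine (hJ1 n _).trans_lt ?_
      rw [div_lt_iff₀ (by positivity)] at hN
      have : (N : ℝ) ≤ n := by exact_mod_cast hn
      nlinarith
    have h3 : J n x - x = J n (x - z) + (J n z - z) + (z - x) := by rw [map_sub]; abel
    rw [dist_eq_norm] at hxz
    rw [dist_eq_norm, h3]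
    have h4 := hJ1 n (x - z)
    have h5 := norm_sub_rev z x
    linarith [norm_add_le (J n (x - z) + (J n z - z)) (z - x),
      norm_add_le (J n (x - z)) (J n z - z)]
  refine ⟨fun n => l n • (J n - 1), fun n x => ?_, fun m n => ?_, fun n x => ?_, fun x => ?_⟩
  · have h1 := (Complex.re_le_norm _).trans (norm_inner_le_norm (𝕜 := ℂ) x (J n x))
    have h2 : (inner ℂ x ((l n • (J n - 1)) x)).re
        = ((n : ℝ) + 1) * ((inner ℂ x (J n x)).re - ‖x‖ ^ 2) := by
      rw [smul_apply, sub_apply, one_apply_eq_self,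
        inner_smul_right, inner_sub_right, hl, Complex.re_ofReal_mul, Complex.sub_re,
        inner_self_eq_norm_sq_to_K]
      congr 2
      exact_mod_cast Complex.ofReal_re _
    rw [h2]
    refine mul_nonpos_of_nonneg_of_nonpos (hpos n).le ?_
    nlinarith [hJ1 n x, norm_nonneg x]
  · exact ((((hcomm m n).sub_left (Commute.one_left _)).sub_right
      ((Commute.one_right _).sub_left (Commute.one_left _))).smul_left _).smul_right _
  · rw [hY]; exact hJ1 n _
  · simp only [hY]; exact hJlim _

end Resolvent

/-! ### The limit of the approximating semigroups. -/

section Generation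

variable {H : Type*} [NormedAddCommGroup H] [InnerProductSpace ℂ H]

/-- Uniformly bounded families converge pointwise on closed sets. -/
theorem cauchySeq_of_dense {E : ℕ → H →L[ℂ] H} (hE : ∀ n x, ‖E n x‖ ≤ ‖x‖) {D : Set H}
    (hD : Dense D) (h : ∀ x ∈ D, CauchySeq fun n => E n x) (x : H) : CauchySeq fun n => E n x := by
  rw [Metric.cauchySeq_iff']
  intro ε hε
  obtain ⟨z, hz, hxz⟩ := hD.exists_dist_lt x (show 0 < ε / 3 by positivity)
  obtain ⟨N, hN⟩ := Metric.cauchySeq_iff'.1 (h z hz) (ε / 3) (by positivity)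
  refine ⟨N, fun n hn => ?_⟩
  have h1 := hN n hn
  rw [dist_eq_norm] at h1 hxz ⊢
  have e : E n x - E N x = E n (x - z) + (E n z - E N z) - E N (x - z) := by
    simp only [map_sub]; abel
  rw [e]
  linarith [hE n (x - z), hE N (x - z), norm_add_le (E n (x - z)) (E n z - E N z),
    norm_sub_le (E n (x - z) + (E n z - E N z)) (E N (x - z))]

theorem tendsto_of_dense {ι : Type*} {l : Filter ι} {E : ι → H →L[ℂ] H} (hE : ∀ i x, ‖E i x‖ ≤ ‖x‖)
    {D : Set H} (hD : Dense D) (h : ∀ x ∈ D, Tendsto (fun i => E i x) l (𝓝 x)) (x : H) :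
    Tendsto (fun i => E i x) l (𝓝 x) := by
  rw [Metric.tendsto_nhds]
  intro ε hε
  obtain ⟨z, hz, hxz⟩ := hD.exists_dist_lt x (show 0 < ε / 3 by positivity)
  filter_upwards [Metric.tendsto_nhds.1 (h z hz) (ε / 3) (by positivity)] with i h1
  rw [dist_eq_norm] at h1 hxz ⊢
  have e : E i x - x = E i (x - z) + (E i z - z) - (x - z) := by
    simp only [map_sub]; abel
  rw [e]
  linarith [hE i (x - z), norm_add_le (E i (x - z)) (E i z - z),
    norm_sub_le (E i (x - z) + (E i z - z)) (x - z)]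

/-- The Lumer–Phillips theorem in Hilbert space. -/
theorem IsMDissipative.exists_semigroup [CompleteSpace H] {A : H →ₗ.[ℂ] H} (hA : IsMDissipative A) :
    ∃ T : C0Semigroup H, T.IsGenerator A ∧ T.IsContraction := by
  obtain ⟨Y, hYd, hYc, hYb, hYl⟩ := hA.exists_yosida
  have hE : ∀ (t : ℝ≥0) n x, ‖expGroup (Y n) t x‖ ≤ ‖x‖ := fun t n x =>
    norm_expGroup_apply_le (hYd n) t.coe_nonneg x
  have hcau : ∀ (t : ℝ≥0) x, CauchySeq fun n => expGroup (Y n) t x := by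
    intro t
    refine cauchySeq_of_dense (hE t) hA.dense fun x hx => ?_
    have hc := (hYl ⟨x, hx⟩).cauchySeq
    rw [Metric.cauchySeq_iff'] at hc ⊢
    intro ε hε
    obtain ⟨N, hN⟩ := hc (ε / (t + 1)) (by positivity)
    refine ⟨N, fun n hn => ?_⟩
    have h1 : dist (Y n x) (Y N x) < ε / (t + 1) := hN n hn
    rw [dist_eq_norm] at h1 ⊢
    refine (norm_expGroup_sub_le (hYd n) (hYd N) (hYc n N) t.coe_nonneg x).trans_lt ?_
    rw [lt_div_iff₀ (by positivity)] at h1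
    nlinarith [norm_nonneg (Y n x - Y N x)]
  choose F hF using fun t x => cauchySeq_tendsto_of_complete (hcau t x)
  have hF1 : ∀ t x, ‖F t x‖ ≤ ‖x‖ := fun t x =>
    le_of_tendsto (hF t x).norm (Eventually.of_forall fun n => hE t n x)
  let Tl : ℝ≥0 → H →ₗ[ℂ] H := fun t =>
    { toFun := F t
      map_add' := fun x y => tendsto_nhds_unique (hF t (x + y))
        (((hF t x).add (hF t y)).congr fun n => (map_add _ _ _).symm)
      map_smul' := fun c x => tendsto_nhds_unique (hF t (c • x))
        (((hF t x).const_smul c).congr fun n => (map_smul _ _ _).symm) }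
  let T : ℝ≥0 → H →L[ℂ] H := fun t => (Tl t).mkContinuous 1 fun x => by
    rw [one_mul]; exact hF1 t x
  have hT : ∀ t x, T t x = F t x := fun t x => rfl
  have hrem : ∀ (t : ℝ≥0) (x z : A.domain),
      ‖T t x - x - ((t : ℝ) : ℂ) • A x‖ ≤ t * (t * ‖A z‖ + 2 * ‖A x - z‖) := by
    intro t x z
    refine le_of_tendsto_of_tendsto (((hF t x).sub_const _).sub ((hYl x).const_smul _)).norm
      (((tendsto_const_nhds (x := (t : ℝ) * ‖A z‖)).add
        (((hYl x).sub_const (z : H)).norm.const_mul 2)).const_mul (t : ℝ))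
      (Eventually.of_forall fun n => ?_)
    refine (norm_expGroup_remainder_le (hYd n) t.coe_nonneg x z).trans ?_
    have := hYb n z
    show (t : ℝ) * (t * ‖Y n z‖ + 2 * ‖Y n x - z‖) ≤ t * (t * ‖A z‖ + 2 * ‖Y n x - z‖)
    gcongr
  have hstrong : ∀ x, Tendsto (fun t => T t x) (𝓝 0) (𝓝 x) := by
    refine tendsto_of_dense hF1 hA.dense fun x hx => ?_
    rw [tendsto_iff_norm_sub_tendsto_zero]
    have hb : ∀ t : ℝ≥0, ‖T t x - x‖ ≤ t * ‖A ⟨x, hx⟩‖ := fun t =>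
      le_of_tendsto_of_tendsto ((hF t x).sub_const x).norm ((hYl ⟨x, hx⟩).norm.const_mul (t : ℝ))
        (Eventually.of_forall fun n => norm_expGroup_apply_sub_le (hYd n) t.coe_nonneg x)
    refine squeeze_zero (fun _ => norm_nonneg _) hb ?_
    have : Continuous fun t : ℝ≥0 => (t : ℝ) * ‖A ⟨x, hx⟩‖ := by fun_prop
    simpa using this.tendsto 0
  have hgen : ∀ x : A.domain, Tendsto (fun t : ℝ≥0 => ((t : ℝ) : ℂ)⁻¹ • (T t x - (x : H)))
      (𝓝[>] 0) (𝓝 (A x)) := by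
    intro x
    rw [Metric.tendsto_nhds]
    intro ε hε
    -- `A x` need not lie in the domain; `z` is a nearby point that does, and it feeds the remainder
    -- bound `hrem`.
    obtain ⟨z, hz, hxz⟩ := hA.dense.exists_dist_lt (A x) (show 0 < ε / 4 by positivity)
    have hlim : Tendsto (fun t : ℝ≥0 => (t : ℝ) * ‖A ⟨z, hz⟩‖) (𝓝[>] 0) (𝓝 0) := by
      have : Continuous fun t : ℝ≥0 => (t : ℝ) * ‖A ⟨z, hz⟩‖ := by fun_prop
      simpa using (this.tendsto 0).mono_left nhdsWithin_le_nhds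
    filter_upwards [hlim.eventually_lt_const (show 0 < ε / 2 by positivity), self_mem_nhdsWithin]
      with t ht ht0
    have ht0' : (0 : ℝ) < t := ht0
    have h1 := hrem t x ⟨z, hz⟩
    have e : ((t : ℝ) : ℂ)⁻¹ • (T t x - (x : H)) - A x
        = ((t : ℝ) : ℂ)⁻¹ • (T t x - (x : H) - ((t : ℝ) : ℂ) • A x) := by
      rw [smul_sub _ (T t x - (x : H)), inv_smul_smul₀ (Complex.ofReal_ne_zero.2 ht0'.ne')]
    rw [dist_eq_norm] at hxz ⊢
    rw [e, norm_smul, norm_inv, Complex.norm_real, Real.norm_of_nonneg ht0'.le,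
      inv_mul_lt_iff₀ ht0']
    refine h1.trans_lt (mul_lt_mul_of_pos_left ?_ ht0')
    linarith
  let S : C0Semigroup H :=
    { toFun := T
      map_zero := by
        ext x
        refine tendsto_nhds_unique (hF 0 x) ?_
        simp [expGroup_zero]
      map_add := by
        intro s t
        ext x
        have h1 : Tendsto (fun n => expGroup (Y n) s (expGroup (Y n) t x - F t x)) atTop (𝓝 0) := by
          refine squeeze_zero_norm (fun n => hE s n _) ?_
          simpa using ((hF t x).sub_const (F t x)).norm
        have h2 := h1.add (hF s (F t x))
        rw [zero_add] at h2
        refine tendsto_nhds_unique (hF (s + t) x) (h2.congr fun n => ?_)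
        rw [← map_add, sub_add_cancel, NNReal.coe_add, expGroup_add]
        rfl
      tendsto_zero := hstrong }
  refine ⟨S, fun x y => ⟨fun h => ?_, fun h => ?_⟩, fun t => (T t).opNorm_le_bound zero_le_one
    fun x => by rw [one_mul]; exact hF1 t x⟩
  · obtain ⟨x', rfl, rfl⟩ := (LinearPMap.mem_graph_iff A).1 h
    exact hgen x'
  -- Maximality of `A`: if the quotients of `x` converge to `y`, solve `x' - A x' = x - y`. Then `v
  -- = x - x'` has quotients converging to `v` itself, while contractivity makes the limit of `Re
  -- ⟨v, (T t v - v) / t⟩` nonpositive. So `‖v‖² ≤ 0`.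
  · obtain ⟨x', hx'⟩ := hA.surjective 1 one_pos (x - y)
    rw [Complex.ofReal_one, one_smul] at hx'
    have h1 := h.sub (hgen x')
    have h2 : y - A x' = x - x' := by
      have : A x' = x' - (x - y) := by rw [← hx', sub_sub_cancel]
      rw [this]; abel
    rw [h2] at h1
    have h3 : (inner ℂ (x - x') (x - (x' : H))).re ≤ 0 := by
      have hc : Tendsto (fun t : ℝ≥0 => (inner ℂ (x - x') (((t : ℝ) : ℂ)⁻¹ • (S.toFun t x - x)
          - ((t : ℝ) : ℂ)⁻¹ • (T t x' - (x' : H)))).re) (𝓝[>] 0)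
          (𝓝 (inner ℂ (x - x') (x - (x' : H))).re) :=
        (Complex.continuous_re.tendsto _).comp (tendsto_const_nhds.inner h1)
      refine le_of_tendsto hc (Eventually.of_forall fun t => ?_)
      have e : ((t : ℝ) : ℂ)⁻¹ • (S.toFun t x - x) - ((t : ℝ) : ℂ)⁻¹ • (T t x' - (x' : H))
          = (((t : ℝ)⁻¹ : ℝ) : ℂ) • (T t (x - x') - (x - x')) := by
        rw [Complex.ofReal_inv, ← smul_sub, map_sub]
        congr 1
        show T t x - x - (T t x' - x') = _
        abel
      rw [e, inner_smul_right, Complex.re_ofReal_mul, inner_sub_right, Complex.sub_re,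
        inner_self_eq_norm_sq_to_K]
      refine mul_nonpos_of_nonneg_of_nonpos (by positivity) ?_
      have h4 := (Complex.re_le_norm _).trans (norm_inner_le_norm (𝕜 := ℂ) (x - x') (T t (x - x')))
      have h5 : ((((‖x - (x' : H)‖ : ℝ) : ℂ)) ^ 2).re = ‖x - (x' : H)‖ ^ 2 := by
        exact_mod_cast Complex.ofReal_re _
      have h6 : ‖T t (x - x')‖ ≤ ‖x - (x' : H)‖ := hF1 t _
      have h7 := mul_le_mul_of_nonneg_left h6 (norm_nonneg (x - (x' : H)))
      erw [h5]
      linarith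
    have h4 : x = x' := by
      rw [← sub_eq_zero, ← norm_eq_zero, ← sq_eq_zero_iff]
      refine le_antisymm ?_ (sq_nonneg _)
      refine le_trans (le_of_eq ?_) h3
      rw [inner_self_eq_norm_sq_to_K]
      exact_mod_cast (Complex.ofReal_re _).symm
    rw [h4, sub_self] at h2
    rw [LinearPMap.mem_graph_iff]
    exact ⟨x', h4.symm, (sub_eq_zero.1 h2).symm⟩

end Generation

end DissipativeSemigroup

/-! ## Orbits of a contraction semigroup -/

namespace C0Semigroup

variable {H : Type*} [NormedAddCommGroup H] [InnerProductSpace ℂ H] {T : C0Semigroup H}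
  {A : H →ₗ.[ℂ] H}

theorem IsContraction.norm_apply_le (hc : T.IsContraction) (t : ℝ≥0) (x : H) :
    ‖T.toFun t x‖ ≤ ‖x‖ := by
  simpa using (T.toFun t).le_of_opNorm_le (hc t) x

theorem map_add_apply (T : C0Semigroup H) (s t : ℝ≥0) (x : H) :
    T.toFun (s + t) x = T.toFun s (T.toFun t x) := by
  rw [T.map_add]; rfl

theorem toFun_comm (T : C0Semigroup H) (s t : ℝ≥0) (x : H) :
    T.toFun s (T.toFun t x) = T.toFun t (T.toFun s x) := by
  rw [← T.map_add_apply, add_comm, T.map_add_apply]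

/-- `T t` is continuous and commutes with the difference quotients at `0`. -/
theorem IsGenerator.apply_mem (hg : T.IsGenerator A) (t : ℝ≥0) (x : A.domain) :
    ∃ h : T.toFun t x ∈ A.domain, A ⟨T.toFun t x, h⟩ = T.toFun t (A x) := by
  have h1 := (hg x (A x)).1 (LinearPMap.mem_graph A x)
  have h2 : (T.toFun t x, T.toFun t (A x)) ∈ A.graph := by
    rw [hg]
    refine (((T.toFun t).continuous.tendsto _).comp h1).congr fun s => ?_
    rw [Function.comp_apply, map_smul, map_sub, T.toFun_comm]
  obtain ⟨y, hy, hy'⟩ := (LinearPMap.mem_graph_iff A).1 h2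
  change (y : H) = T.toFun t x at hy
  change A y = T.toFun t (A x) at hy'
  have hm : T.toFun t x ∈ A.domain := hy ▸ y.2
  refine ⟨hm, ?_⟩
  rw [← hy']
  congr 1
  exact Subtype.ext hy.symm

theorem IsContraction.continuous_orbit (hc : T.IsContraction) (x : H) :
    Continuous fun t : ℝ => T.toFun t.toNNReal x := by
  -- Subtraction in `ℝ≥0` is truncated, so `(t - s) + (s - t)` is `|t - s|`.
  have key : ∀ s t : ℝ≥0, ‖T.toFun t x - T.toFun s x‖ ≤ ‖T.toFun ((t - s) + (s - t)) x - x‖ := by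
    intro s t
    rcases le_total s t with h | h
    · have e : T.toFun t x - T.toFun s x = T.toFun s (T.toFun (t - s) x - x) := by
        rw [map_sub, ← T.map_add_apply, add_tsub_cancel_of_le h]
      rw [e, tsub_eq_zero_of_le h, add_zero]
      exact hc.norm_apply_le _ _
    · have e : T.toFun t x - T.toFun s x = -T.toFun t (T.toFun (s - t) x - x) := by
        rw [map_sub, ← T.map_add_apply, add_tsub_cancel_of_le h, neg_sub]
      rw [e, tsub_eq_zero_of_le h, zero_add, norm_neg]
      exact hc.norm_apply_le _ _
  have h : Continuous fun t : ℝ≥0 => T.toFun t x := by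
    rw [continuous_iff_continuousAt]
    intro s
    rw [ContinuousAt, tendsto_iff_norm_sub_tendsto_zero]
    refine squeeze_zero (fun _ => norm_nonneg _) (fun t => key s t) ?_
    have h1 : Tendsto (fun t : ℝ≥0 => (t - s) + (s - t)) (𝓝 s) (𝓝 0) := by
      have : Continuous fun t : ℝ≥0 => (t - s) + (s - t) := by fun_prop
      simpa using this.tendsto s
    have h2 := (((T.tendsto_zero x).comp h1).sub_const x).norm
    simpa using h2
  exact h.comp continuous_real_toNNReal

/-- The definition of the generator directly yields a right derivative; the constancy and comparison
arguments below need no more. -/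
theorem IsGenerator.hasDerivWithinAt (hg : T.IsGenerator A) (x : A.domain) {t : ℝ} (ht : 0 ≤ t) :
    HasDerivWithinAt (fun s : ℝ => T.toFun s.toNNReal x) (T.toFun t.toNNReal (A x)) (Ici t) t := by
  obtain ⟨hm, he⟩ := hg.apply_mem t.toNNReal x
  have h1 := (hg _ _).1 (LinearPMap.mem_graph A ⟨_, hm⟩)
  rw [he] at h1
  rw [← hasDerivWithinAt_Ioi_iff_Ici, hasDerivWithinAt_iff_tendsto_slope' (by simp)]
  have h2 : Tendsto (fun s : ℝ => (s - t).toNNReal) (𝓝[>] t) (𝓝[>] 0) := by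
    rw [tendsto_nhdsWithin_iff]
    constructor
    · have : Continuous fun s : ℝ => (s - t).toNNReal := by fun_prop
      simpa using (this.tendsto t).mono_left nhdsWithin_le_nhds
    · filter_upwards [self_mem_nhdsWithin] with s hs
      exact Real.toNNReal_pos.2 (sub_pos.2 hs)
  refine (h1.comp h2).congr' ?_
  filter_upwards [self_mem_nhdsWithin] with s hs
  have hs' : 0 ≤ s - t := (sub_pos.2 hs).le
  rw [Function.comp_apply, slope_def_module, Real.coe_toNNReal _ hs', ← T.map_add_apply,
    ← Real.toNNReal_add hs' ht, sub_add_cancel, ← Complex.ofReal_inv]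
  exact Complex.coe_smul _ _

/-- A continuous functional that vanishes on the range of the generator is conserved. -/
theorem IsGenerator.conserved (hg : T.IsGenerator A) (hc : T.IsContraction)
    (hd : Dense (A.domain : Set H)) (f : H →L[ℂ] ℂ) (hf : ∀ x : A.domain, f (A x) = 0)
    (t : ℝ≥0) (x : H) : f (T.toFun t x) = f x := by
  have hcl : IsClosed {x | f (T.toFun t x) = f x} :=
    isClosed_eq (f.continuous.comp (T.toFun t).continuous) f.continuous
  refine hcl.closure_subset_iff.2 ?_ (hd x)
  intro x hx
  have h1 := constant_of_has_deriv_right_zero (f := fun s : ℝ => f (T.toFun s.toNNReal x))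
    (a := 0) (b := t) (f.continuous.comp (hc.continuous_orbit x)).continuousOn (fun s hs => by
      have h := hg.hasDerivWithinAt ⟨x, hx⟩ hs.1
      obtain ⟨hm, he⟩ := hg.apply_mem s.toNNReal ⟨x, hx⟩
      have h2 := (f.restrictScalars ℝ).hasFDerivAt.comp_hasDerivWithinAt s h
      rw [ContinuousLinearMap.coe_restrictScalars', ← he, hf] at h2
      exact h2) t ⟨t.2, le_rfl⟩
  simpa [T.map_zero] using h1

/-- Exponential decay from a quadratic Lyapunov functional. -/
theorem IsGenerator.decay (hg : T.IsGenerator A) (hc : T.IsContraction) {K : Set H}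
    (hK : ∀ x ∈ K, ∀ t, T.toFun t x ∈ K) (P : H →L[ℂ] H) {a b r : ℝ} (ha : 0 < a)
    (hlow : ∀ x ∈ K, a * ‖x‖ ^ 2 ≤ (inner ℂ x (P x)).re)
    (hupp : ∀ x ∈ K, (inner ℂ x (P x)).re ≤ b * ‖x‖ ^ 2)
    (hdiss : ∀ x : A.domain, (x : H) ∈ K → (inner ℂ (A x) (P x)).re + (inner ℂ (x : H) (P (A x))).re
      ≤ -(2 * r) * (inner ℂ (x : H) (P x)).re) (t : ℝ≥0) (x : A.domain) (hx : (x : H) ∈ K) :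
    ‖T.toFun t x‖ ≤ √(b / a) * Real.exp (-r * t) * ‖(x : H)‖ := by
  set f : ℝ → H := fun s => T.toFun s.toNNReal x with hf
  have hfc : Continuous f := hc.continuous_orbit x
  set Q : ℝ → ℝ := fun s => (inner ℂ (f s) (P (f s))).re with hQ
  have hQc : Continuous Q := Complex.continuous_re.comp (hfc.inner (P.continuous.comp hfc))
  have hQd : ∀ s, 0 ≤ s → ∃ Q', HasDerivWithinAt Q Q' (Ici s) s ∧ Q' ≤ -(2 * r) * Q s := by
    intro s hs
    have h := hg.hasDerivWithinAt x hs
    obtain ⟨hm, he⟩ := hg.apply_mem s.toNNReal x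
    have hP := (P.restrictScalars ℝ).hasFDerivAt.comp_hasDerivWithinAt s h
    have hi := Complex.reCLM.hasFDerivAt.comp_hasDerivWithinAt s (h.inner ℂ hP)
    refine ⟨_, hi, ?_⟩
    -- `P` is not assumed self-adjoint, so the derivative of `Re ⟨x, P x⟩` has two separate terms,
    -- as in `hdiss`.
    have hd := hdiss ⟨_, hm⟩ (hK _ hx _)
    rw [he] at hd
    refine le_trans (le_of_eq ?_) hd
    simp only [Complex.reCLM_apply, Complex.add_re]
    exact add_comm _ _
  choose! Q' hQ' hQle using hQd
  have hW : Q t ≤ Q 0 * Real.exp (-(2 * r) * t) := by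
    -- Gronwall's argument: `e^{2rs} Q s` has nonpositive right derivative, hence stays below `Q 0`.
    have hd : ∀ s ∈ Ico 0 (t : ℝ), HasDerivWithinAt (fun s => Real.exp (2 * r * s) * Q s)
        (Real.exp (2 * r * s) * (2 * r) * Q s + Real.exp (2 * r * s) * Q' s) (Ici s) s := by
      intro s hs
      have h2 : HasDerivAt (fun s => Real.exp (2 * r * s)) (Real.exp (2 * r * s) * (2 * r)) s := by
        simpa using ((hasDerivAt_id s).const_mul (2 * r)).exp
      exact h2.hasDerivWithinAt.mul (hQ' s hs.1)
    have hle : ∀ s ∈ Ico 0 (t : ℝ),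
        Real.exp (2 * r * s) * (2 * r) * Q s + Real.exp (2 * r * s) * Q' s ≤ 0 := by
      intro s hs
      have h3 := mul_le_mul_of_nonneg_left (hQle s hs.1) (Real.exp_pos (2 * r * s)).le
      linarith
    have hcont : Continuous fun s => Real.exp (2 * r * s) * Q s :=
      (Real.continuous_exp.comp (continuous_const.mul continuous_id)).mul hQc
    have h1 := image_le_of_deriv_right_le_deriv_boundary (B := fun _ => Q 0) (B' := fun _ => 0)
      hcont.continuousOn hd (by simp) continuousOn_const
      (fun s _ => hasDerivWithinAt_const s _ (Q 0)) hle (right_mem_Icc.2 t.coe_nonneg)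
    rw [neg_mul, Real.exp_neg, ← div_eq_mul_inv, le_div_iff₀ (Real.exp_pos _), mul_comm]
    exact h1
  have hf0 : f 0 = x := by simp [hf, T.map_zero]
  have hft : f t = T.toFun t x := by simp [hf]
  have h1 := hlow _ (hK _ hx t)
  have h2 := hupp _ hx
  simp only [hQ, hf0, hft] at hW
  have h3 : ‖T.toFun t x‖ ^ 2 ≤ (b / a) * (Real.exp (-(2 * r) * t) * ‖(x : H)‖ ^ 2) := by
    rw [div_mul_eq_mul_div, le_div_iff₀ ha]
    nlinarith [mul_le_mul_of_nonneg_right h2 (Real.exp_pos (-(2 * r) * t)).le]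
  have h4 : 0 ≤ Real.exp (-r * t) * ‖(x : H)‖ := by positivity
  calc ‖T.toFun t x‖ = √(‖T.toFun t x‖ ^ 2) := (Real.sqrt_sq (norm_nonneg _)).symm
    _ ≤ √((b / a) * (Real.exp (-r * t) * ‖(x : H)‖) ^ 2) := by
      refine Real.sqrt_le_sqrt (h3.trans_eq ?_)
      rw [mul_pow, ← Real.exp_nat_mul]
      congr 3
      push_cast
      ring_nf
    _ = _ := by rw [Real.sqrt_mul' _ (sq_nonneg _), Real.sqrt_sq h4, mul_assoc]

end C0Semigroup

namespace ThermoBeam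

/-! ## Primitives in `L²(0, L)` -/

section Primitive

variable {L : ℝ}

theorem integrable_coeFn (f : L2 L) : Integrable f (volume.restrict (Ioo 0 L)) :=
  (Lp.memLp f).integrable (by norm_num)

theorem L2_inner_eq (f g : L2 L) : inner ℂ f g = ∫ x in Ioo 0 L, conj (f x) * g x := by
  rw [L2.inner_def]
  refine integral_congr_ae (Eventually.of_forall fun x => ?_)
  simp only [RCLike.inner_apply]
  ring

/-- The constant function `1`. -/
noncomputable def oneL2 (L : ℝ) : L2 L := Lp.const 2 (volume.restrict (Ioo 0 L)) 1

theorem coeFn_oneL2 (L : ℝ) : oneL2 L =ᵐ[volume.restrict (Ioo 0 L)] fun _ => (1 : ℂ) :=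
  Lp.coeFn_const _ _ _

theorem inner_oneL2 (f : L2 L) : inner ℂ (oneL2 L) f = ∫ x in Ioo 0 L, f x := by
  rw [L2_inner_eq]
  refine integral_congr_ae ?_
  filter_upwards [coeFn_oneL2 L] with x hx
  rw [hx, map_one, one_mul]

/-- The primitive of `f` that vanishes at `0`. -/
noncomputable def prim (f : L2 L) (x : ℝ) : ℂ := ∫ y in Iic x, f y ∂(volume.restrict (Ioo 0 L))

theorem prim_congr {f : L2 L} {g : ℝ → ℂ} (h : f =ᵐ[volume.restrict (Ioo 0 L)] g) {x : ℝ}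
    (hx : x ∈ Icc 0 L) : prim f x = ∫ y in (0 : ℝ)..x, (Ioo 0 L).indicator g y := by
  rw [prim, setIntegral_congr_ae measurableSet_Iic (h.mono fun y hy _ => hy),
    intervalIntegral.integral_of_le hx.1, setIntegral_indicator measurableSet_Ioo,
    Measure.restrict_restrict measurableSet_Iic]
  congr 2
  ext y
  simp only [mem_inter_iff, mem_Iic, mem_Ioo, mem_Ioc]
  grind

theorem continuousOn_prim (f : L2 L) : ContinuousOn (prim f) (Icc 0 L) := by
  have hi : Integrable ((Ioo 0 L).indicator f) volume :=
    (integrable_indicator_iff measurableSet_Ioo).2 (integrable_coeFn f)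
  have hc := intervalIntegral.continuous_primitive (fun a b => hi.intervalIntegrable (a := a) (b := b)) 0
  exact hc.continuousOn.congr fun x hx => prim_congr (Eventually.of_forall fun _ => rfl) hx

theorem prim_zero (hL : 0 ≤ L) (f : L2 L) : prim f 0 = 0 := by
  rw [prim_congr (Eventually.of_forall fun _ => rfl) (left_mem_Icc.2 hL)]
  simp

theorem prim_right (f : L2 L) : prim f L = inner ℂ (oneL2 L) f := by
  rw [prim, inner_oneL2, Measure.restrict_restrict measurableSet_Iic, inter_eq_right.2]
  exact fun y hy => hy.2.le

/-- Cauchy–Schwarz against the indicator of `(-∞, x]`. -/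
theorem norm_prim_le (f : L2 L) (x : ℝ) : ‖prim f x‖ ≤ √((volume.restrict (Ioo 0 L)).real univ) * ‖f‖ := by
  have h := L2.inner_indicatorConstLp_one (𝕜 := ℂ) (μ := volume.restrict (Ioo 0 L))
    (measurableSet_Iic (a := x)) (measure_ne_top _ _) f
  rw [prim, ← h]
  refine (norm_inner_le_norm _ _).trans (mul_le_mul_of_nonneg_right ?_ (norm_nonneg _))
  refine norm_indicatorConstLp_le.trans ?_
  rw [norm_one, one_mul, ENNReal.toReal_ofNat, ← Real.sqrt_eq_rpow]
  exact Real.sqrt_le_sqrt (measureReal_mono (subset_univ _))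

theorem memLp_prim (f : L2 L) : MemLp (prim f) 2 (volume.restrict (Ioo 0 L)) :=
  MemLp.of_bound (((continuousOn_prim f).mono Ioo_subset_Icc_self).aestronglyMeasurable
    measurableSet_Ioo) (√((volume.restrict (Ioo 0 L)).real univ) * ‖f‖) (Eventually.of_forall (norm_prim_le f))

theorem prim_add (f g : L2 L) (x : ℝ) : prim (f + g) x = prim f x + prim g x := by
  rw [prim, prim, prim, ← integral_add (integrable_coeFn f).integrableOn
    (integrable_coeFn g).integrableOn]
  exact setIntegral_congr_ae measurableSet_Iic ((Lp.coeFn_add f g).mono fun y hy _ => hy)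

theorem prim_smul (c : ℂ) (f : L2 L) (x : ℝ) : prim (c • f) x = c * prim f x := by
  rw [prim, prim, ← integral_const_mul]
  exact setIntegral_congr_ae measurableSet_Iic ((Lp.coeFn_smul c f).mono fun y hy _ => hy)

/-- The Volterra operator `f ↦ ∫₀ˣ f`. -/
noncomputable def volterra (L : ℝ) : L2 L →L[ℂ] L2 L :=
  LinearMap.mkContinuous
    { toFun := fun f => (memLp_prim f).toLp
      map_add' := fun f g => by
        rw [← MemLp.toLp_add]
        exact MemLp.toLp_congr _ _ (Eventually.of_forall fun x => prim_add f g x)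
      map_smul' := fun c f => by
        rw [RingHom.id_apply, ← MemLp.toLp_const_smul]
        exact MemLp.toLp_congr _ _ (Eventually.of_forall fun x => prim_smul c f x) }
    ((measureUnivNNReal (volume.restrict (Ioo 0 L)) : ℝ) ^ ((2 : ℝ≥0∞).toReal)⁻¹ * √((volume.restrict (Ioo 0 L)).real univ)) (fun f => by
      rw [mul_assoc]
      refine Lp.norm_le_of_ae_bound (by positivity) ?_
      filter_upwards [(memLp_prim f).coeFn_toLp] with x hx
      exact hx ▸ norm_prim_le f x)

theorem coeFn_volterra (f : L2 L) : volterra L f =ᵐ[volume.restrict (Ioo 0 L)] prim f :=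
  (memLp_prim f).coeFn_toLp

/-- The adjoint of the Volterra operator `V` is `f ↦ ⟨1, f⟩ - V f`. -/
theorem inner_volterra_left (f g : L2 L) :
    inner ℂ (volterra L f) g = inner ℂ f (inner ℂ (oneL2 L) g • oneL2 L - volterra L g) := by
  set μ := volume.restrict (Ioo 0 L)
  -- Both sides are iterated integrals of `g x · conj (f y)` over the triangle `y ≤ x`, so the
  -- identity is Fubini's theorem.
  have hT : MeasurableSet {p : ℝ × ℝ | p.2 ≤ p.1} := measurableSet_le measurable_snd measurable_fst
  have hint : Integrable (fun p : ℝ × ℝ =>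
      {p : ℝ × ℝ | p.2 ≤ p.1}.indicator (fun p => g p.1 * conj (f p.2)) p) (μ.prod μ) :=
    Integrable.indicator ((integrable_coeFn g).mul_prod
      ((Complex.conjCLE : ℂ →L[ℝ] ℂ).integrable_comp (integrable_coeFn f))) hT
  have h1 : inner ℂ (volterra L f) g = ∫ x, ∫ y,
      {p : ℝ × ℝ | p.2 ≤ p.1}.indicator (fun p => g p.1 * conj (f p.2)) (x, y) ∂μ ∂μ := by
    rw [L2_inner_eq]
    refine integral_congr_ae ?_
    filter_upwards [coeFn_volterra f] with x hx
    rw [hx, prim, ← integral_conj, mul_comm, ← integral_const_mul, ← integral_indicator measurableSet_Iic]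
    rfl
  have h2 : inner ℂ f (inner ℂ (oneL2 L) g • oneL2 L - volterra L g) = ∫ y, ∫ x,
      {p : ℝ × ℝ | p.2 ≤ p.1}.indicator (fun p => g p.1 * conj (f p.2)) (x, y) ∂μ ∂μ := by
    rw [L2_inner_eq]
    refine integral_congr_ae ?_
    filter_upwards [Lp.coeFn_sub (inner ℂ (oneL2 L) g • oneL2 L) (volterra L g), coeFn_volterra g,
      coeFn_oneL2 L, Lp.coeFn_smul (inner ℂ (oneL2 L) g) (oneL2 L)] with y h1 h2 h3 h4
    rw [h1, Pi.sub_apply, h2, h4, Pi.smul_apply, h3, smul_eq_mul, mul_one, inner_oneL2]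
    -- The integral of `g` over `x ≥ y` is its total integral minus the primitive at `y`.
    have e : ∫ x in Ioo 0 L, g x = prim g y + ∫ x in Ici y, g x ∂μ := by
      rw [prim, ← integral_add_compl (measurableSet_Iic (a := y)) (integrable_coeFn g), compl_Iic,
        integral_Ici_eq_integral_Ioi]
    rw [e, add_sub_cancel_left, ← integral_const_mul, ← integral_indicator measurableSet_Ici]
    refine integral_congr_ae (Eventually.of_forall fun x => ?_)
    by_cases hxy : y ≤ x
    · simp [indicator, hxy, mul_comm]
    · simp [indicator, hxy]
  rw [h1, h2]
  exact integral_integral_swap hint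

/-- Integration by parts in its basic form: for `g` of zero mean, the primitive of `g` vanishes at
both ends and no boundary term remains. -/
theorem inner_volterra_left_of_mean_zero (f : L2 L) {g : L2 L} (hg : inner ℂ (oneL2 L) g = 0) :
    inner ℂ (volterra L f) g = -inner ℂ f (volterra L g) := by
  rw [inner_volterra_left, hg, zero_smul, zero_sub, inner_neg_right]

/-- Coefficients as bounded operators. -/
noncomputable def mulByL (a : ℝ → ℝ) (ha : ContinuousOn a (Icc 0 L)) : L2 L →L[ℂ] L2 L :=
  LinearMap.mkContinuousOfExistsBound (mulBy a ha) (by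
    obtain ⟨C, hC⟩ := isCompact_Icc.exists_bound_of_continuousOn ha
    refine ⟨C, fun f => Lp.norm_le_mul_norm_of_ae_le_mul ?_⟩
    filter_upwards [coeFn_mulBy a ha f, ae_restrict_mem measurableSet_Ioo] with x hx hm
    rw [hx, norm_mul, Complex.norm_real]
    exact mul_le_mul_of_nonneg_right (hC x (Ioo_subset_Icc_self hm)) (norm_nonneg _))

theorem mulByL_apply (a : ℝ → ℝ) (ha : ContinuousOn a (Icc 0 L)) (f : L2 L) :
    mulByL a ha f = mulBy a ha f := rfl

end Primitive

end ThermoBeam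

namespace ThermoBeam

/-! ## Weak derivatives and primitives -/

section WeakDeriv

variable {L : ℝ}

/-- A test function is `V ψ` with `ψ = φ'` of zero mean, so the defining identity of the weak
derivative is the adjoint formula for `V`. -/
theorem isWeakDeriv_volterra (hL : 0 < L) (g : L2 L) : IsWeakDeriv L (volterra L g) g := by
  intro φ h1 h2 h3
  have hd : Continuous (deriv φ) := h1.continuous_deriv (by simp)
  have hφ0 : ∀ x, x ∉ Ioo 0 L → φ x = 0 := fun x hx =>
    image_eq_zero_of_notMem_tsupport fun h => hx (h3 h)
  have hm : MemLp (fun x => ((deriv φ x : ℝ) : ℂ)) 2 (volume.restrict (Ioo 0 L)) :=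
    ((Complex.continuous_ofReal.comp hd).memLp_of_hasCompactSupport
      (h2.deriv.comp_left Complex.ofReal_zero)).restrict _
  set ψ : L2 L := hm.toLp with hψ
  have hψc : ψ =ᵐ[volume.restrict (Ioo 0 L)] fun x => ((deriv φ x : ℝ) : ℂ) := hm.coeFn_toLp
  have hprim : ∀ x ∈ Icc 0 L, prim ψ x = φ x := by
    intro x hx
    have hcongr : (∫ y in (0 : ℝ)..x, (Ioo 0 L).indicator (fun x => ((deriv φ x : ℝ) : ℂ)) y)
        = ∫ y in (0 : ℝ)..x, ((deriv φ y : ℝ) : ℂ) := by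
      refine intervalIntegral.integral_congr fun y _ => indicator_apply_eq_self.2 fun hy => ?_
      have : deriv φ y = 0 := image_eq_zero_of_notMem_tsupport fun h =>
        hy (h3 (closure_minimal (support_deriv_subset) (isClosed_tsupport _) h))
      simp [this]
    rw [prim_congr hψc hx, hcongr, intervalIntegral.integral_ofReal,
      intervalIntegral.integral_deriv_eq_sub (fun y _ => (h1.differentiable (by simp)).differentiableAt)
        (hd.intervalIntegrable _ _), hφ0 0 (by simp), sub_zero]
  have hmean : inner ℂ (oneL2 L) ψ = 0 := by
    rw [← prim_right, hprim L (right_mem_Icc.2 hL.le), hφ0 L (by simp), Complex.ofReal_zero]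
  have hV : volterra L ψ =ᵐ[volume.restrict (Ioo 0 L)] fun x => (φ x : ℂ) := by
    filter_upwards [coeFn_volterra ψ, ae_restrict_mem measurableSet_Ioo] with x hx hm
    rw [hx, hprim x (Ioo_subset_Icc_self hm)]
  have e1 : ∫ x in Ioo 0 L, deriv φ x • volterra L g x = inner ℂ ψ (volterra L g) := by
    rw [L2_inner_eq]
    refine integral_congr_ae ?_
    filter_upwards [hψc] with x hx
    rw [hx, Complex.conj_ofReal, Complex.real_smul]
  have e2 : ∫ x in Ioo 0 L, φ x • g x = inner ℂ (volterra L ψ) g := by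
    rw [L2_inner_eq]
    refine integral_congr_ae ?_
    filter_upwards [hV] with x hx
    rw [hx, Complex.conj_ofReal, Complex.real_smul]
  rw [e1, e2, ← inner_conj_symm ψ, inner_volterra_left_of_mean_zero g hmean, map_neg,
    inner_conj_symm]

/-- The du Bois-Reymond lemma: an element with zero weak derivative is constant. -/
theorem exists_eq_const_of_isWeakDeriv_zero (hL : 0 < L) {f : L2 L}
    (h : IsWeakDeriv L f (0 : L2 L)) : ∃ k : ℂ, f = k • oneL2 L := by
  let B : ContDiffBump (L / 2) := ⟨L / 8, L / 4, by positivity, by linarith⟩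
  let ρ : ℝ → ℝ := B.normed volume
  have hρ : ContDiff ℝ ∞ ρ := B.contDiff_normed
  have hρs : tsupport ρ ⊆ Ioo 0 L := by
    rw [B.tsupport_normed_eq, Real.closedBall_eq_Icc]
    intro x hx
    have h1 : L / 2 - L / 4 ≤ x := hx.1
    have h2 : x ≤ L / 2 + L / 4 := hx.2
    exact ⟨by linarith, by linarith⟩
  have hρc : HasCompactSupport ρ := B.hasCompactSupport_normed
  have hρi : ∫ x, ρ x = 1 := B.integral_normed
  have hρne : (tsupport ρ).Nonempty := by
    rw [B.tsupport_normed_eq]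
    exact ⟨L / 2, Metric.mem_closedBall_self B.rOut_pos.le⟩
  set k : ℂ := ∫ x in Ioo 0 L, ρ x • f x with hk
  have hfi : Integrable f (volume.restrict (Ioo 0 L)) := integrable_coeFn f
  have hconst : ∀ᵐ x ∂(volume : Measure ℝ), x ∈ Ioo 0 L → f x - k = 0 := by
    refine isOpen_Ioo.ae_eq_zero_of_integral_contDiff_smul_eq_zero ?_ ?_
    · have hi : IntegrableOn (fun x => f x - k) (Ioo 0 L) := hfi.sub (integrable_const k)
      exact hi.locallyIntegrableOn
    · intro ψ h1 h2 h3
      have hψi : Integrable ψ := h1.continuous.integrable_of_hasCompactSupport h2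
      have hρint : Integrable ρ := hρ.continuous.integrable_of_hasCompactSupport hρc
      -- Subtracting `(∫ ψ) ρ`, where `ρ` has mass one, makes `ψ` integrate to zero and hence the
      -- derivative of a test function; testing with it gives `∫ ψ (f - k) = 0`.
      obtain ⟨φ, hφ, hφc, hφs, hφd⟩ := exists_test_primitive (L := L)
        (g := fun x => ψ x - (∫ y, ψ y) * ρ x) (h1.sub (contDiff_const.mul hρ))
        (IsCompact.union h2 hρc) (hρne.mono subset_union_right) (union_subset h3 hρs)
        (fun x hx => by
          rw [mem_union, not_or] at hx
          simp [image_eq_zero_of_notMem_tsupport hx.1, image_eq_zero_of_notMem_tsupport hx.2])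
        (by rw [integral_sub hψi (hρint.const_mul _), integral_const_mul, hρi]; ring)
      have e := h φ hφ hφc hφs
      have e0 : ∫ x in Ioo 0 L, φ x • (0 : L2 L) x = 0 := by
        rw [integral_congr_ae (g := fun _ => (0 : ℂ))]
        · simp
        · filter_upwards [Lp.coeFn_zero ℂ 2 (volume.restrict (Ioo 0 L))] with x hx
          rw [hx]; simp
      have e1 : ∫ x in Ioo 0 L, (ψ x - (∫ y, ψ y) * ρ x) • f x
          = (∫ x in Ioo 0 L, ψ x • f x) - (∫ y, ψ y) • k := by
        rw [hk, ← integral_smul]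
        refine Eq.trans ?_ (integral_sub (integrable_smul_of_continuous h1.continuous f)
          ((integrable_smul_of_continuous hρ.continuous f).smul (∫ y, ψ y)))
        refine integral_congr_ae (Eventually.of_forall fun x => ?_)
        simp only [sub_smul, mul_smul]
      rw [hφd, e0, neg_zero, e1] at e
      have e2 : ∫ x in Ioo 0 L, ψ x = ∫ x, ψ x :=
        setIntegral_eq_integral_of_forall_compl_eq_zero fun x hx =>
          image_eq_zero_of_notMem_tsupport (fun hx' => hx (h3 hx'))
      have e3 : ∫ x, ψ x • (f x - k) = ∫ x in Ioo 0 L, ψ x • (f x - k) := by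
        refine (setIntegral_eq_integral_of_forall_compl_eq_zero fun x hx => ?_).symm
        rw [image_eq_zero_of_notMem_tsupport (fun hx' => hx (h3 hx')), zero_smul]
      rw [e3]
      simp only [smul_sub]
      rw [integral_sub (integrable_smul_of_continuous h1.continuous f)
        (hψi.integrableOn.smul_const k), integral_smul_const, e2]
      exact e
  refine ⟨k, Lp.ext ?_⟩
  rw [← ae_restrict_iff' measurableSet_Ioo] at hconst
  filter_upwards [hconst, Lp.coeFn_smul k (oneL2 L), coeFn_oneL2 L] with x hx h1 h2
  rw [h1, Pi.smul_apply, h2, smul_eq_mul, mul_one, sub_eq_zero.1 hx]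

theorem IsWeakDeriv.mem {f g : L2 L} (h : IsWeakDeriv L f g) : f ∈ H1 L := ⟨g, h⟩

theorem IsWeakDeriv.weakDeriv_eq {f g : L2 L} (h : IsWeakDeriv L f g) : weakDeriv f = g :=
  (isWeakDeriv_weakDeriv h.mem).unique h

theorem isWeakDeriv_oneL2 (L : ℝ) : IsWeakDeriv L (oneL2 L) (0 : L2 L) := by
  intro φ h1 h2 h3
  have hd : Continuous (deriv φ) := h1.continuous_deriv (by simp)
  have e0 : ∫ x in Ioo 0 L, φ x • (0 : L2 L) x = 0 := by
    rw [integral_congr_ae (g := fun _ => (0 : ℂ))]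
    · simp
    · filter_upwards [Lp.coeFn_zero ℂ 2 (volume.restrict (Ioo 0 L))] with x hx
      rw [hx]; simp
  have e1 : ∫ x in Ioo 0 L, deriv φ x • oneL2 L x = ∫ x in Ioo 0 L, ((deriv φ x : ℝ) : ℂ) := by
    refine integral_congr_ae ?_
    filter_upwards [coeFn_oneL2 L] with x hx
    rw [hx, Complex.real_smul, mul_one]
  have e2 : ∫ x in Ioo 0 L, deriv φ x = ∫ x, deriv φ x := by
    refine setIntegral_eq_integral_of_forall_compl_eq_zero fun x hx => ?_
    exact image_eq_zero_of_notMem_tsupport fun h =>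
      hx (h3 (closure_minimal (support_deriv_subset) (isClosed_tsupport _) h))
  rw [e0, e1, neg_zero, integral_complex_ofReal, e2, Complex.ofReal_eq_zero]
  exact integral_eq_zero_of_hasDerivAt_of_integrable
    (fun x => (h1.differentiable (by simp)).differentiableAt.hasDerivAt)
    (hd.integrable_of_hasCompactSupport h2.deriv) (h1.continuous.integrable_of_hasCompactSupport h2)

/-- An element of `H¹` is the primitive of its derivative, up to a constant. -/
theorem exists_eq_volterra_add_const (hL : 0 < L) {f : L2 L} (hf : f ∈ H1 L) :
    ∃ k : ℂ, f = volterra L (weakDeriv f) + k • oneL2 L := by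
  have h1 := (isWeakDeriv_weakDeriv hf).add ((isWeakDeriv_volterra hL (weakDeriv f)).smul (-1))
  rw [neg_one_smul, neg_one_smul, add_neg_cancel] at h1
  obtain ⟨k, hk⟩ := exists_eq_const_of_isWeakDeriv_zero hL h1
  exact ⟨k, by rw [← hk]; abel⟩

/-- The continuous representative equals the primitive of the derivative plus a constant on all of
`[0, L]`. Its value at `0` kills the constant, and its value at `L` is then the mean of the
derivative. With `volterra_mem_H10` this identifies `H¹₀` with the mean-zero part of `L²`. -/
theorem H10.eq_volterra (hL : 0 < L) {f : L2 L} (hf : f ∈ H10 L) :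
    inner ℂ (oneL2 L) (weakDeriv f) = 0 ∧ f = volterra L (weakDeriv f) := by
  obtain ⟨k, hk⟩ := exists_eq_volterra_add_const hL hf.1
  obtain ⟨-, c, hc, hfc, hc0, hcL⟩ := hf
  have hEq : EqOn c (fun x => prim (weakDeriv f) x + k) (Icc 0 L) := by
    refine Measure.eqOn_Icc_of_ae_eq (μ := volume) hL.ne ?_ hc
      ((continuousOn_prim _).add continuousOn_const)
    rw [← restrict_Ioo_eq_restrict_Icc]
    refine hfc.symm.trans ?_
    have h1 := Lp.coeFn_add (volterra L (weakDeriv f)) (k • oneL2 L)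
    rw [← hk] at h1
    filter_upwards [h1, coeFn_volterra (weakDeriv f), Lp.coeFn_smul k (oneL2 L), coeFn_oneL2 L]
      with x h1 h2 h3 h4
    rw [h1, Pi.add_apply, h2, h3, Pi.smul_apply, h4, smul_eq_mul, mul_one]
  have hk0 : k = 0 := by
    have := hEq (left_mem_Icc.2 hL.le)
    simpa [hc0, prim_zero hL.le] using this.symm
  subst hk0
  rw [zero_smul, add_zero] at hk
  refine ⟨?_, hk⟩
  have := hEq (right_mem_Icc.2 hL.le)
  simpa [hcL, prim_right] using this.symm

theorem volterra_mem_H10 (hL : 0 < L) {b : L2 L} (hb : inner ℂ (oneL2 L) b = 0) :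
    volterra L b ∈ H10 L :=
  ⟨(isWeakDeriv_volterra hL b).mem, prim b, continuousOn_prim b, coeFn_volterra b,
    prim_zero hL.le b, by rw [prim_right, hb]⟩

theorem weakDeriv_volterra (hL : 0 < L) (b : L2 L) : weakDeriv (volterra L b) = b :=
  (isWeakDeriv_volterra hL b).weakDeriv_eq

/-- Integration by parts. -/
theorem inner_weakDeriv_left (hL : 0 < L) {f g : L2 L} (hf : f ∈ H1 L) (hg : g ∈ H10 L) :
    inner ℂ (weakDeriv f) g = -inner ℂ f (weakDeriv g) := by
  obtain ⟨h0, hV⟩ := H10.eq_volterra hL hg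
  obtain ⟨k, hk⟩ := exists_eq_volterra_add_const hL hf
  have h1 : inner ℂ f (weakDeriv g)
      = inner ℂ (volterra L (weakDeriv f)) (weakDeriv g) + inner ℂ (k • oneL2 L) (weakDeriv g) := by
    rw [← inner_add_left, ← hk]
  rw [h1, inner_smul_left, h0, mul_zero, add_zero, inner_volterra_left_of_mean_zero _ h0, ← hV,
    neg_neg]

theorem inner_weakDeriv_right (hL : 0 < L) {f g : L2 L} (hf : f ∈ H10 L) (hg : g ∈ H1 L) :
    inner ℂ f (weakDeriv g) = -inner ℂ (weakDeriv f) g := by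
  rw [← inner_conj_symm, inner_weakDeriv_left hL hg hf, map_neg, inner_conj_symm]

/-- An element that satisfies the weak equation `s_x = F` is in `H¹`. -/
theorem isWeakDeriv_of_forall_inner (hL : 0 < L) {s F : L2 L}
    (h : ∀ b : L2 L, inner ℂ (oneL2 L) b = 0 → inner ℂ s b = -inner ℂ F (volterra L b)) :
    IsWeakDeriv L s F := by
  -- The difference `s - V F` is orthogonal to every mean-zero `b`, so it lies in the double
  -- orthogonal complement of the constants: it is a constant.
  have hmem : s - volterra L F ∈ (ℂ ∙ oneL2 L)ᗮᗮ := by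
    rw [Submodule.mem_orthogonal']
    intro b hb
    have hb0 := Submodule.mem_orthogonal_singleton_iff_inner_right.1 hb
    rw [inner_sub_left, h b hb0, inner_volterra_left_of_mean_zero F hb0, sub_self]
  rw [Submodule.orthogonal_orthogonal, Submodule.mem_span_singleton] at hmem
  obtain ⟨k, hk⟩ := hmem
  have h1 := (isWeakDeriv_volterra hL F).add ((isWeakDeriv_oneL2 L).smul k)
  rw [hk, smul_zero, add_zero, add_sub_cancel] at h1
  exact h1

end WeakDeriv

end ThermoBeam

namespace ThermoBeam

/-! ## Multiplication operators -/

section Multiplication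

variable {L : ℝ} {a : ℝ → ℝ}

theorem inner_mulByL_left (ha : ContinuousOn a (Icc 0 L)) (f g : L2 L) :
    inner ℂ (mulByL a ha f) g = inner ℂ f (mulByL a ha g) := by
  rw [mulByL_apply, mulByL_apply, ← inner_mulBy_symm, inner_conj_symm]

theorem inner_mulByL_symm (ha : ContinuousOn a (Icc 0 L)) (f g : L2 L) :
    (inner ℂ f (mulByL a ha g)).re = (inner ℂ g (mulByL a ha f)).re := by
  rw [mulByL_apply, mulByL_apply, ← inner_mulBy_symm, Complex.conj_re]

theorem inner_mulByL_self_nonneg (ha : ContinuousOn a (Icc 0 L)) (hp : ∀ x ∈ Icc 0 L, 0 ≤ a x)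
    (f : L2 L) : 0 ≤ (inner ℂ f (mulByL a ha f)).re := by
  rw [mulByL_apply, inner_mulBy_self, Complex.ofReal_re]
  exact setIntegral_nonneg measurableSet_Ioo fun x hx =>
    mul_nonneg (hp x (Ioo_subset_Icc_self hx)) (sq_nonneg _)

theorem inner_mulByL_self_le (ha : ContinuousOn a (Icc 0 L)) (f : L2 L) :
    (inner ℂ f (mulByL a ha f)).re ≤ ‖mulByL a ha‖ * ‖f‖ ^ 2 := by
  refine (Complex.re_le_norm _).trans ((norm_inner_le_norm _ _).trans ?_)
  nlinarith [(mulByL a ha).le_opNorm f, norm_nonneg f]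

theorem re_inner_self {E : Type*} [NormedAddCommGroup E] [InnerProductSpace ℂ E] (x : E) :
    (inner ℂ x x).re = ‖x‖ ^ 2 := by
  rw [inner_self_eq_norm_sq_to_K]
  exact_mod_cast Complex.ofReal_re _

/-- The constant is the minimum of `a` on `[0, L]`; multiplication by `a - min a` is a nonnegative
operator. -/
theorem exists_coercive_mulByL (hL : 0 < L) (ha : ContinuousOn a (Icc 0 L))
    (hp : ∀ x ∈ Icc 0 L, 0 < a x) :
    ∃ c > 0, ∀ f : L2 L, c * ‖f‖ ^ 2 ≤ (inner ℂ f (mulByL a ha f)).re := by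
  obtain ⟨x₀, hx₀, hmin⟩ := isCompact_Icc.exists_isMinOn (nonempty_Icc.2 hL.le) ha
  refine ⟨a x₀, hp x₀ hx₀, fun f => ?_⟩
  have hb : ContinuousOn (fun x => a x - a x₀) (Icc 0 L) := ha.sub continuousOn_const
  have h := inner_mulByL_self_nonneg hb (fun x hx => sub_nonneg.2 (hmin hx)) f
  have e : mulByL (fun x => a x - a x₀) hb f = mulByL a ha f - (a x₀ : ℂ) • f := by
    refine Lp.ext ?_
    filter_upwards [coeFn_mulBy _ hb f, coeFn_mulBy a ha f, Lp.coeFn_smul (a x₀ : ℂ) f,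
      Lp.coeFn_sub (mulByL a ha f) ((a x₀ : ℂ) • f)] with x h1 h2 h3 h4
    rw [mulByL_apply, h1, h4, Pi.sub_apply, mulByL_apply, h2, h3, Pi.smul_apply, smul_eq_mul]
    push_cast
    ring
  rw [e, inner_sub_right, Complex.sub_re, inner_smul_right, Complex.re_ofReal_mul,
    re_inner_self] at h
  linarith

theorem mulBy_mulBy_inv (ha : ContinuousOn a (Icc 0 L)) (hp : ∀ x ∈ Icc 0 L, 0 < a x)
    (hi : ContinuousOn (fun x => (a x)⁻¹) (Icc 0 L)) (f : L2 L) :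
    mulBy a ha (mulBy (fun x => (a x)⁻¹) hi f) = f := by
  refine Lp.ext ?_
  filter_upwards [coeFn_mulBy a ha (mulBy (fun x => (a x)⁻¹) hi f), coeFn_mulBy _ hi f,
    ae_restrict_mem measurableSet_Ioo] with x h1 h2 h3
  have : (a x : ℂ) ≠ 0 := Complex.ofReal_ne_zero.2 (hp x (Ioo_subset_Icc_self h3)).ne'
  rw [h1, h2, Complex.ofReal_inv, mul_inv_cancel_left₀ this]

theorem mulBy_inv_mulBy (ha : ContinuousOn a (Icc 0 L)) (hp : ∀ x ∈ Icc 0 L, 0 < a x)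
    (hi : ContinuousOn (fun x => (a x)⁻¹) (Icc 0 L)) (f : L2 L) :
    mulBy (fun x => (a x)⁻¹) hi (mulBy a ha f) = f := by
  refine Lp.ext ?_
  filter_upwards [coeFn_mulBy _ hi (mulBy a ha f), coeFn_mulBy _ ha f,
    ae_restrict_mem measurableSet_Ioo] with x h1 h2 h3
  have : (a x : ℂ) ≠ 0 := Complex.ofReal_ne_zero.2 (hp x (Ioo_subset_Icc_self h3)).ne'
  rw [h1, h2, Complex.ofReal_inv, inv_mul_cancel_left₀ this]

end Multiplication

/-! ## The phase space as a Hilbert space -/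

section PhaseSpace

variable {S : Data}

/-- The strain `u_x` of a state. -/
noncomputable def Phase.du (U : Phase S) : L2 S.L := weakDeriv (U.u : L2 S.L)

theorem weakDeriv_zero {L : ℝ} : weakDeriv (0 : L2 L) = 0 := (isWeakDeriv_zero L).weakDeriv_eq

theorem phase_inner (U V : Phase S) :
    inner ℂ U V = inner ℂ U.du (mulByL S.p S.p_reg.1 V.du) + inner ℂ U.w (mulByL S.m S.m_reg.1 V.w)
      + inner ℂ U.θ V.θ + (S.τ : ℂ) * inner ℂ U.q V.q :=
  energyInner_eq S U V

theorem phase_norm_sq (U : Phase S) :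
    ‖U‖ ^ 2 = (inner ℂ U.du (mulByL S.p S.p_reg.1 U.du)).re
      + (inner ℂ U.w (mulByL S.m S.m_reg.1 U.w)).re + ‖U.θ‖ ^ 2 + S.τ * ‖U.q‖ ^ 2 := by
  rw [← re_inner_self, phase_inner]
  simp only [Complex.add_re, Complex.re_ofReal_mul, re_inner_self]

theorem exists_phase_norm_sq_le (S : Data) : ∃ K > 0, ∀ U : Phase S,
    ‖U‖ ^ 2 ≤ K * (‖U.du‖ ^ 2 + ‖U.w‖ ^ 2 + ‖U.θ‖ ^ 2 + ‖U.q‖ ^ 2) := by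
  have hτ := S.τ_pos
  refine ⟨‖mulByL S.p S.p_reg.1‖ + ‖mulByL S.m S.m_reg.1‖ + 1 + S.τ, by positivity, fun U => ?_⟩
  rw [phase_norm_sq]
  have h1 := inner_mulByL_self_le S.p_reg.1 U.du
  have h2 := inner_mulByL_self_le S.m_reg.1 U.w
  have h3 : ∀ {x y : ℝ}, 0 ≤ x → 0 ≤ y → 0 ≤ x * y := mul_nonneg
  nlinarith [h3 (norm_nonneg (mulByL S.p S.p_reg.1)) (sq_nonneg ‖U.w‖),
    h3 (norm_nonneg (mulByL S.p S.p_reg.1)) (sq_nonneg ‖U.θ‖),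
    h3 (norm_nonneg (mulByL S.p S.p_reg.1)) (sq_nonneg ‖U.q‖),
    h3 (norm_nonneg (mulByL S.m S.m_reg.1)) (sq_nonneg ‖U.du‖),
    h3 (norm_nonneg (mulByL S.m S.m_reg.1)) (sq_nonneg ‖U.θ‖),
    h3 (norm_nonneg (mulByL S.m S.m_reg.1)) (sq_nonneg ‖U.q‖),
    h3 hτ.le (sq_nonneg ‖U.du‖), h3 hτ.le (sq_nonneg ‖U.w‖), h3 hτ.le (sq_nonneg ‖U.θ‖),
    sq_nonneg ‖U.du‖, sq_nonneg ‖U.w‖, sq_nonneg ‖U.q‖]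

/-- Together with `exists_phase_norm_sq_le`, this makes the energy norm equivalent to the `L²` norms
of `(u_x, w, θ, q)`. -/
theorem exists_le_phase_norm (S : Data) : ∃ K, ∀ U : Phase S,
    ‖U.du‖ ≤ K * ‖U‖ ∧ ‖U.w‖ ≤ K * ‖U‖ ∧ ‖U.θ‖ ≤ K * ‖U‖ ∧ ‖U.q‖ ≤ K * ‖U‖ := by
  obtain ⟨c, hc, hp⟩ := exists_coercive_mulByL S.L_pos S.p_reg.1 S.p_pos
  obtain ⟨d, hd, hm⟩ := exists_coercive_mulByL S.L_pos S.m_reg.1 S.m_pos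
  have hτ := S.τ_pos
  obtain ⟨e, he, hec, hed, he1, heτ⟩ : ∃ e > 0, e ≤ c ∧ e ≤ d ∧ e ≤ 1 ∧ e ≤ S.τ :=
    ⟨min (min c d) (min 1 S.τ), by positivity, by simp, by simp, by simp, by simp⟩
  have key : ∀ U : Phase S, ∀ x : ℝ, 0 ≤ x → e * x ^ 2 ≤ ‖U‖ ^ 2 → x ≤ √(1 / e) * ‖U‖ := by
    intro U x hx h
    rw [← Real.sqrt_sq (norm_nonneg U), ← Real.sqrt_mul (by positivity)]
    refine Real.le_sqrt_of_sq_le ?_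
    rw [one_div_mul_eq_div, le_div_iff₀ he]
    linarith
  refine ⟨√(1 / e), fun U => ?_⟩
  have h0 := phase_norm_sq U
  have h1 := hp U.du
  have h2 := hm U.w
  have h3 := inner_mulByL_self_nonneg S.p_reg.1 (fun x hx => (S.p_pos x hx).le) U.du
  have h4 := inner_mulByL_self_nonneg S.m_reg.1 (fun x hx => (S.m_pos x hx).le) U.w
  have h5 := mul_le_mul_of_nonneg_right hec (sq_nonneg ‖U.du‖)
  have h6 := mul_le_mul_of_nonneg_right hed (sq_nonneg ‖U.w‖)
  have h7 := mul_le_mul_of_nonneg_right he1 (sq_nonneg ‖U.θ‖)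
  have h8 := mul_le_mul_of_nonneg_right heτ (sq_nonneg ‖U.q‖)
  have h9 : 0 ≤ S.τ * ‖U.q‖ ^ 2 := by positivity
  have h10 := sq_nonneg ‖U.θ‖
  refine ⟨key U _ (norm_nonneg _) ?_, key U _ (norm_nonneg _) ?_, key U _ (norm_nonneg _) ?_,
    key U _ (norm_nonneg _) ?_⟩ <;> linarith

/-- The strain as a bounded operator. -/
noncomputable def duL (S : Data) : Phase S →L[ℂ] L2 S.L :=
  LinearMap.mkContinuousOfExistsBound
    { toFun := Phase.du
      map_add' := fun U V => weakDeriv_add (H10_le_H1 _ U.u.2) (H10_le_H1 _ V.u.2)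
      map_smul' := fun c U => weakDeriv_smul c (H10_le_H1 _ U.u.2) }
    ((exists_le_phase_norm S).imp fun _ h U => (h U).1)

/-- The velocity as a bounded operator. -/
noncomputable def wL (S : Data) : Phase S →L[ℂ] L2 S.L :=
  LinearMap.mkContinuousOfExistsBound
    { toFun := Phase.w, map_add' := fun _ _ => rfl, map_smul' := fun _ _ => rfl }
    ((exists_le_phase_norm S).imp fun _ h U => (h U).2.1)

/-- The temperature as a bounded operator. -/
noncomputable def θL (S : Data) : Phase S →L[ℂ] L2 S.L :=
  LinearMap.mkContinuousOfExistsBound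
    { toFun := Phase.θ, map_add' := fun _ _ => rfl, map_smul' := fun _ _ => rfl }
    ((exists_le_phase_norm S).imp fun _ h U => (h U).2.2.1)

/-- The heat flux as a bounded operator. -/
noncomputable def qL (S : Data) : Phase S →L[ℂ] L2 S.L :=
  LinearMap.mkContinuousOfExistsBound
    { toFun := Phase.q, map_add' := fun _ _ => rfl, map_smul' := fun _ _ => rfl }
    ((exists_le_phase_norm S).imp fun _ h U => (h U).2.2.2)

theorem Phase.u_eq_volterra (U : Phase S) : (U.u : L2 S.L) = volterra S.L U.du :=
  (H10.eq_volterra S.L_pos U.u.2).2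

theorem Phase.du_mk (u : H10 S.L) (w θ q : L2 S.L) : (mk u w θ q).du = weakDeriv (u : L2 S.L) := rfl

theorem Phase.du_mk_zero (w θ q : L2 S.L) : (mk (0 : H10 S.L) w θ q).du = 0 := weakDeriv_zero

theorem exists_bound_of_phase_norm_sq {f : L2 S.L → Phase S}
    (hf : ∀ x, ‖(f x).du‖ ^ 2 + ‖(f x).w‖ ^ 2 + ‖(f x).θ‖ ^ 2 + ‖(f x).q‖ ^ 2 ≤ ‖x‖ ^ 2) :
    ∃ C, ∀ x, ‖f x‖ ≤ C * ‖x‖ := by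
  obtain ⟨K, hK, h⟩ := exists_phase_norm_sq_le S
  refine ⟨√K, fun x => ?_⟩
  rw [← Real.sqrt_sq (norm_nonneg x), ← Real.sqrt_mul hK.le]
  exact Real.le_sqrt_of_sq_le ((h _).trans (mul_le_mul_of_nonneg_left (hf x) hK.le))

/-- The state with velocity `f` and no other component. -/
noncomputable def wEmb (S : Data) : L2 S.L →L[ℂ] Phase S :=
  LinearMap.mkContinuousOfExistsBound
    { toFun := fun f => Phase.mk 0 f 0 0
      map_add' := fun f g => Phase.ext' (add_zero _).symm rfl (add_zero _).symm (add_zero _).symm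
      map_smul' := fun c f => Phase.ext' (smul_zero _).symm rfl (smul_zero _).symm (smul_zero _).symm }
    (exists_bound_of_phase_norm_sq fun f => by simp [Phase.du_mk_zero])

/-- The state with temperature `f` and no other component. -/
noncomputable def θEmb (S : Data) : L2 S.L →L[ℂ] Phase S :=
  LinearMap.mkContinuousOfExistsBound
    { toFun := fun f => Phase.mk 0 0 f 0
      map_add' := fun f g => Phase.ext' (add_zero _).symm (add_zero _).symm rfl (add_zero _).symm
      map_smul' := fun c f => Phase.ext' (smul_zero _).symm (smul_zero _).symm rfl (smul_zero _).symm }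
    (exists_bound_of_phase_norm_sq fun f => by simp [Phase.du_mk_zero])

/-- The state with heat flux `f` and no other component. -/
noncomputable def qEmb (S : Data) : L2 S.L →L[ℂ] Phase S :=
  LinearMap.mkContinuousOfExistsBound
    { toFun := fun f => Phase.mk 0 0 0 f
      map_add' := fun f g => Phase.ext' (add_zero _).symm (add_zero _).symm (add_zero _).symm rfl
      map_smul' := fun c f => Phase.ext' (smul_zero _).symm (smul_zero _).symm (smul_zero _).symm rfl }
    (exists_bound_of_phase_norm_sq fun f => by simp [Phase.du_mk_zero])

theorem wEmb_apply (f : L2 S.L) : wEmb S f = Phase.mk 0 f 0 0 := rfl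
theorem qEmb_apply (f : L2 S.L) : qEmb S f = Phase.mk 0 0 0 f := rfl

theorem inner_wEmb (U : Phase S) (f : L2 S.L) :
    inner ℂ U (wEmb S f) = inner ℂ U.w (mulByL S.m S.m_reg.1 f) := by
  rw [phase_inner, wEmb_apply, Phase.du_mk_zero]
  simp

theorem inner_qEmb (U : Phase S) (f : L2 S.L) :
    inner ℂ U (qEmb S f) = (S.τ : ℂ) * inner ℂ U.q f := by
  rw [phase_inner, qEmb_apply, Phase.du_mk_zero]
  simp

/-- The map `U ↦ (u_x, w, θ, q)` embeds the phase space in four copies of `L²`, boundedly in both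
directions. Its range is cut out by the closed condition that the first component has zero mean. -/
noncomputable instance : CompleteSpace (Phase S) := by
  let Φ : Phase S →L[ℂ] (L2 S.L × L2 S.L × L2 S.L × L2 S.L) :=
    (duL S).prod ((wL S).prod ((θL S).prod (qL S)))
  have hΦ : ∀ U, Φ U = (U.du, U.w, U.θ, U.q) := fun _ => rfl
  obtain ⟨K, hK, h⟩ := exists_phase_norm_sq_le S
  have hanti : AntilipschitzWith ⟨√(4 * K), Real.sqrt_nonneg _⟩ Φ := by
    refine Φ.antilipschitz_of_bound fun U => ?_
    show ‖U‖ ≤ √(4 * K) * ‖Φ U‖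
    rw [← Real.sqrt_sq (norm_nonneg (Φ U)), ← Real.sqrt_mul (by positivity)]
    refine Real.le_sqrt_of_sq_le ((h U).trans ?_)
    have h1 : ‖U.du‖ ≤ ‖Φ U‖ := norm_fst_le (Φ U)
    have h2 : ‖U.w‖ ≤ ‖Φ U‖ := (norm_fst_le _).trans (norm_snd_le (Φ U))
    have h3 : ‖U.θ‖ ≤ ‖Φ U‖ := (norm_fst_le _).trans ((norm_snd_le _).trans (norm_snd_le (Φ U)))
    have h4 : ‖U.q‖ ≤ ‖Φ U‖ := (norm_snd_le _).trans ((norm_snd_le _).trans (norm_snd_le (Φ U)))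
    have h1' := pow_le_pow_left₀ (norm_nonneg _) h1 2
    have h2' := pow_le_pow_left₀ (norm_nonneg _) h2 2
    have h3' := pow_le_pow_left₀ (norm_nonneg _) h3 2
    have h4' := pow_le_pow_left₀ (norm_nonneg _) h4 2
    nlinarith
  rw [completeSpace_iff_isComplete_range (hanti.isUniformInducing Φ.uniformContinuous)]
  have hr : range Φ = {x | inner ℂ (oneL2 S.L) x.1 = 0} := by
    ext ⟨a, w, θ, q⟩
    constructor
    · rintro ⟨U, hU⟩
      rw [hΦ] at hU
      have : U.du = a := congrArg Prod.fst hU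
      rw [mem_ofPred_eq, ← this]
      exact (H10.eq_volterra S.L_pos U.u.2).1
    · intro ha
      refine ⟨Phase.mk ⟨volterra S.L a, volterra_mem_H10 S.L_pos ha⟩ w θ q, ?_⟩
      rw [hΦ, Phase.du_mk, weakDeriv_volterra S.L_pos]
      rfl
  rw [hr]
  exact (isClosed_eq (continuous_const.inner continuous_fst) continuous_const).isComplete

end PhaseSpace

end ThermoBeam

namespace ThermoBeam

variable {S : Data}

/-! ## Dissipativity -/

section Operator

/-- The total stress `p u_x + 2 δ w_x - η θ`. -/
noncomputable def totalStress (U : Phase S) : L2 S.L := stress S U - (S.η : ℂ) • U.θ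

theorem totalStress_mem (U : (operator S).domain) : totalStress (U : Phase S) ∈ H1 S.L :=
  (H1 _).sub_mem U.2.2.1 ((H1 _).smul_mem _ U.2.2.2.1)

theorem totalStress_eq (U : Phase S) : totalStress U = mulByL S.p S.p_reg.1 U.du
    + (2 : ℂ) • mulByL S.δ S.δ_reg.1 (weakDeriv U.w) - (S.η : ℂ) • U.θ := rfl

theorem operator_u (U : (operator S).domain) :
    ((operator S U).u : L2 S.L) = (U : Phase S).w := rfl

theorem operator_du (U : (operator S).domain) :
    (operator S U).du = weakDeriv (U : Phase S).w := rfl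

/-- Multiplied by `m`, the form in which the velocity enters the energy inner product; `operator_q`
carries the factor `τ` for the same reason. -/
theorem operator_w (U : (operator S).domain) :
    mulByL S.m S.m_reg.1 (operator S U).w = weakDeriv (totalStress (U : Phase S)) :=
  mulBy_mulBy_inv S.m_reg.1 S.m_pos (continuousOn_inv_m S) _

theorem operator_θ (U : (operator S).domain) : (operator S U).θ
    = -((S.κ : ℂ) • weakDeriv (U : Phase S).q) - (S.η : ℂ) • weakDeriv (U : Phase S).w := rfl

theorem operator_q (U : (operator S).domain) : (S.τ : ℂ) • (operator S U).q
    = -((S.κ : ℂ) • weakDeriv (U : Phase S).θ + (S.β : ℂ) • (U : Phase S).q) := by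
  have : (operator S U).q = -((S.τ : ℂ)⁻¹ • ((S.κ : ℂ) • weakDeriv (U : Phase S).θ
    + (S.β : ℂ) • (U : Phase S).q)) := rfl
  rw [this, smul_neg, smul_inv_smul₀ (Complex.ofReal_ne_zero.2 S.τ_pos.ne')]

theorem re_inner_comm {E : Type*} [NormedAddCommGroup E] [InnerProductSpace ℂ E] (x y : E) :
    (inner ℂ x y).re = (inner ℂ y x).re := by
  rw [← inner_conj_symm, Complex.conj_re]

/-- The energy identity. Since `w` and `q` vanish at the ends, integration by parts leaves no
boundary terms; the elastic, the `η` and the `κ` terms then cancel in pairs in the real part,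
leaving viscous and flux damping. -/
theorem re_inner_operator (U : (operator S).domain) :
    (inner ℂ (U : Phase S) (operator S U)).re
      = -2 * (inner ℂ (weakDeriv (U : Phase S).w)
          (mulByL S.δ S.δ_reg.1 (weakDeriv (U : Phase S).w))).re - S.β * ‖(U : Phase S).q‖ ^ 2 := by
  obtain ⟨hw, -, hθ, hq⟩ := U.2
  rw [phase_inner, operator_w, operator_du, operator_θ, ← inner_smul_right (U : Phase S).q,
    operator_q, inner_weakDeriv_right S.L_pos hw (totalStress_mem U), totalStress_eq]
  simp only [inner_add_right, inner_sub_right, inner_neg_right, inner_smul_right,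
    inner_weakDeriv_right S.L_pos hq hθ, Complex.add_re, Complex.sub_re, Complex.neg_re,
    Complex.re_ofReal_mul, mul_neg]
  rw [inner_mulByL_symm S.p_reg.1, re_inner_comm (U : Phase S).θ, re_inner_comm (U : Phase S).θ,
    re_inner_self, show (2 : ℂ) = ((2 : ℝ) : ℂ) by norm_num, Complex.re_ofReal_mul]
  ring

theorem operator_dissipative (U : (operator S).domain) :
    (inner ℂ (U : Phase S) (operator S U)).re ≤ 0 := by
  rw [re_inner_operator]
  have h1 := inner_mulByL_self_nonneg S.δ_reg.1 (fun x hx => (S.δ_pos x hx).le)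
    (weakDeriv (U : Phase S).w)
  have h2 := mul_nonneg S.β_pos.le (sq_nonneg ‖(U : Phase S).q‖)
  linarith

end Operator

/-! ## The resolvent equation -/

section Resolvent

/-- The Lax–Milgram theorem on a closed subspace. -/
theorem exists_of_coercive_on {E : Type*} [NormedAddCommGroup E] [InnerProductSpace ℂ E]
    {K : Submodule ℂ E} [CompleteSpace K] (B : E →L[ℂ] E) {c : ℝ} (hc : 0 < c)
    (hB : ∀ x ∈ K, c * ‖x‖ ^ 2 ≤ (inner ℂ (B x) x).re) (f : E) :
    ∃ x ∈ K, ∀ y ∈ K, inner ℂ (B x) y = inner ℂ f y := by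
  let B' : K →L[ℂ] K := K.orthogonalProjectionOnto ∘L B ∘L K.subtypeL
  have hB' : ∀ x y : K, inner ℂ (B' x) y = inner ℂ (B x) (y : E) := fun x y => by
    simp [B']
  have hlow : ∀ x, ‖x‖ ≤ c⁻¹ * ‖B' x‖ := by
    intro x
    rw [le_inv_mul_iff₀ hc]
    rcases (norm_nonneg x).eq_or_lt with h | h
    · rw [← h, mul_zero]; exact norm_nonneg _
    · have h1 := hB x x.2
      rw [← hB'] at h1
      have h2 := (Complex.re_le_norm _).trans (norm_inner_le_norm (𝕜 := ℂ) (B' x) x)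
      refine le_of_mul_le_mul_right ?_ h
      have h3 : c * ‖x‖ ^ 2 ≤ ‖B' x‖ * ‖x‖ := h1.trans h2
      nlinarith
  have hanti : AntilipschitzWith ⟨c⁻¹, by positivity⟩ B' := B'.antilipschitz_of_bound hlow
  -- The range of the compression `B'` is closed because `B'` is bounded below, and nothing but `0`
  -- is orthogonal to it, by coercivity again.
  have hcl : IsClosed (B'.range : Set K) := hanti.isClosed_range B'.uniformContinuous
  have htop : B'.range = ⊤ := by
    have := hcl.completeSpace_coe
    rw [← B'.range.orthogonal_orthogonal, Submodule.orthogonal_eq_top_iff, Submodule.eq_bot_iff]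
    intro x hx
    have h1 := (Submodule.mem_orthogonal _ _).1 hx (B' x) ⟨x, rfl⟩
    have h2 := hB x x.2
    rw [← hB', h1, Complex.zero_re] at h2
    have h3 : ‖(x : E)‖ ^ 2 ≤ 0 := by
      by_contra hn
      push Not at hn
      nlinarith
    exact Subtype.ext (norm_eq_zero.1 (pow_eq_zero_iff two_ne_zero |>.1
      (le_antisymm h3 (sq_nonneg _))))
  obtain ⟨x, hx⟩ : K.orthogonalProjectionOnto f ∈ B'.range := by rw [htop]; trivial
  refine ⟨x, x.2, fun y hy => ?_⟩
  have h1 := hB' x ⟨y, hy⟩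
  rw [← h1]
  have h2 : B' x = K.orthogonalProjectionOnto f := hx
  rw [h2, Submodule.inner_orthogonalProjectionOnto_eq_of_mem_right ⟨y, hy⟩]

/-- The weak form of the resolvent equation for the unknowns `a = w_x` and `b = q_x`. -/
theorem exists_combined_weak_solution (S : Data) {l : ℝ} (hl : 0 < l) (f g : L2 S.L) :
    ∃ a b : L2 S.L, inner ℂ (oneL2 S.L) a = 0 ∧ inner ℂ (oneL2 S.L) b = 0 ∧
      ∀ a' b' : L2 S.L, inner ℂ (oneL2 S.L) a' = 0 → inner ℂ (oneL2 S.L) b' = 0 →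
        (inner ℂ ((l : ℂ) • mulByL S.m S.m_reg.1 (volterra S.L a)) (volterra S.L a')
          + inner ℂ (((l : ℂ)⁻¹) • mulByL S.p S.p_reg.1 a + (2 : ℂ) • mulByL S.δ S.δ_reg.1 a
            + ((l : ℂ)⁻¹ * S.η) • ((S.η : ℂ) • a + (S.κ : ℂ) • b)) a')
        + (inner ℂ (((l * S.τ + S.β : ℝ) : ℂ) • volterra S.L b) (volterra S.L b')
          + inner ℂ (((l : ℂ)⁻¹ * S.κ) • ((S.η : ℂ) • a + (S.κ : ℂ) • b)) b')
        = inner ℂ f a' + inner ℂ g b' := by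
  obtain ⟨c, hc, hδ⟩ := exists_coercive_mulByL S.L_pos S.δ_reg.1 S.δ_pos
  have hη := S.η_pos
  have hκ := S.κ_pos
  have hτ := S.τ_pos
  have hβ := S.β_pos
  -- The plain product carries the sup norm; the `ℓ²` product is a Hilbert space.
  let E := WithLp 2 (L2 S.L × L2 S.L)
  let e : E ≃L[ℂ] L2 S.L × L2 S.L := WithLp.prodContinuousLinearEquiv 2 ℂ (L2 S.L) (L2 S.L)
  let fst := ContinuousLinearMap.fst ℂ (L2 S.L) (L2 S.L)
  let snd := ContinuousLinearMap.snd ℂ (L2 S.L) (L2 S.L)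
  let V := volterra S.L
  let M := mulByL S.m S.m_reg.1
  let P := mulByL S.p S.p_reg.1
  let D := mulByL S.δ S.δ_reg.1
  let G := (S.η : ℂ) • fst + (S.κ : ℂ) • snd
  let B₁ : L2 S.L × L2 S.L →L[ℂ] L2 S.L := (l : ℂ) • (ContinuousLinearMap.adjoint V ∘L M ∘L V ∘L fst)
    + ((l : ℂ)⁻¹ • (P ∘L fst) + (2 : ℂ) • (D ∘L fst) + ((l : ℂ)⁻¹ * S.η) • G)
  let B₂ : L2 S.L × L2 S.L →L[ℂ] L2 S.L :=
    ((l * S.τ + S.β : ℝ) : ℂ) • (ContinuousLinearMap.adjoint V ∘L V ∘L snd) + ((l : ℂ)⁻¹ * S.κ) • G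
  let B : E →L[ℂ] E := e.symm.toContinuousLinearMap ∘L (B₁.prod B₂) ∘L e.toContinuousLinearMap
  let φ : L2 S.L →L[ℂ] ℂ := innerSL ℂ (oneL2 S.L)
  let K : Submodule ℂ E := (φ ∘L fst ∘L e.toContinuousLinearMap).ker
    ⊓ (φ ∘L snd ∘L e.toContinuousLinearMap).ker
  have hKc : IsClosed (K : Set E) := (ContinuousLinearMap.isClosed_ker _).inter
    (ContinuousLinearMap.isClosed_ker _)
  have : CompleteSpace K := hKc.completeSpace_coe
  have hBi : ∀ x y : E, inner ℂ (B x) y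
      = (inner ℂ ((l : ℂ) • M (V x.fst)) (V y.fst)
          + inner ℂ ((l : ℂ)⁻¹ • P x.fst + (2 : ℂ) • D x.fst
            + ((l : ℂ)⁻¹ * S.η) • ((S.η : ℂ) • x.fst + (S.κ : ℂ) • x.snd)) y.fst)
        + (inner ℂ (((l * S.τ + S.β : ℝ) : ℂ) • V x.snd) (V y.snd)
          + inner ℂ (((l : ℂ)⁻¹ * S.κ) • ((S.η : ℂ) • x.fst + (S.κ : ℂ) • x.snd)) y.snd) := by
    intro x y
    have h1 : (B x).fst = (l : ℂ) • ContinuousLinearMap.adjoint V (M (V x.fst))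
        + ((l : ℂ)⁻¹ • P x.fst + (2 : ℂ) • D x.fst
          + ((l : ℂ)⁻¹ * S.η) • ((S.η : ℂ) • x.fst + (S.κ : ℂ) • x.snd)) := rfl
    have h2 : (B x).snd = ((l * S.τ + S.β : ℝ) : ℂ) • ContinuousLinearMap.adjoint V (V x.snd)
        + ((l : ℂ)⁻¹ * S.κ) • ((S.η : ℂ) • x.fst + (S.κ : ℂ) • x.snd) := rfl
    rw [WithLp.prod_inner_apply]
    change inner ℂ (B x).fst y.fst + inner ℂ (B x).snd y.snd = _
    rw [h1, h2, inner_add_left, inner_add_left (𝕜 := ℂ) (_ • ContinuousLinearMap.adjoint V (V x.snd)),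
      inner_smul_left, inner_smul_left (ContinuousLinearMap.adjoint V (V x.snd)),
      ContinuousLinearMap.adjoint_inner_left, ContinuousLinearMap.adjoint_inner_left,
      ← inner_smul_left, ← inner_smul_left (V x.snd)]
  obtain ⟨k, hk, hcoer⟩ : ∃ k > 0, ∀ x : E, k * ‖x‖ ^ 2 ≤ (inner ℂ (B x) x).re := by
    -- The form dominates `2c ‖a‖² + l⁻¹ ‖h‖²` with `h = η a + κ b`. Since `κ² ‖b‖² ≤ 2 ‖h‖² + 2 η²
    -- ‖a‖²`, both norms are controlled; the two entries of the minimum come from comparing the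
    -- coefficients of `‖h‖²` and `‖a‖²`.
    refine ⟨min (S.κ ^ 2 / (2 * l)) (2 * c * S.κ ^ 2 / (S.κ ^ 2 + 2 * S.η ^ 2)), by positivity,
      fun x => ?_⟩
    set k := min (S.κ ^ 2 / (2 * l)) (2 * c * S.κ ^ 2 / (S.κ ^ 2 + 2 * S.η ^ 2)) with hk
    have hk0 : 0 ≤ k := by positivity
    have hk1 : k * (2 * l) ≤ S.κ ^ 2 := (le_div_iff₀ (by positivity)).1 (min_le_left _ _)
    have hk2 : k * (S.κ ^ 2 + 2 * S.η ^ 2) ≤ 2 * c * S.κ ^ 2 :=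
      (le_div_iff₀ (by positivity)).1 (min_le_right _ _)
    set h := (S.η : ℂ) • x.fst + (S.κ : ℂ) • x.snd with hh
    have e1 : (inner ℂ (B x) x).re = l * (inner ℂ (V x.fst) (M (V x.fst))).re
        + l⁻¹ * (inner ℂ x.fst (P x.fst)).re + 2 * (inner ℂ x.fst (D x.fst)).re
        + (l * S.τ + S.β) * ‖V x.snd‖ ^ 2 + l⁻¹ * ‖h‖ ^ 2 := by
      have e2 : ((l : ℂ)⁻¹ * S.η) = ((l⁻¹ * S.η : ℝ) : ℂ) := by push_cast; rfl
      have e3 : ((l : ℂ)⁻¹ * S.κ) = ((l⁻¹ * S.κ : ℝ) : ℂ) := by push_cast; rfl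
      have e4 : ‖h‖ ^ 2 = S.η * (inner ℂ h x.fst).re + S.κ * (inner ℂ h x.snd).re := by
        rw [← re_inner_self, ← Complex.re_ofReal_mul, ← Complex.re_ofReal_mul, ← inner_smul_right,
          ← inner_smul_right, ← Complex.add_re, ← inner_add_right]
      rw [hBi, ← hh, e2, e3, e4, ← Complex.ofReal_inv, show (2 : ℂ) = ((2 : ℝ) : ℂ) by norm_num]
      simp only [inner_add_left, inner_smul_left, Complex.conj_ofReal, Complex.add_re,
        Complex.re_ofReal_mul, re_inner_self, M, P, D, inner_mulByL_left]
      ring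
    have h1 := inner_mulByL_self_nonneg S.m_reg.1 (fun x hx => (S.m_pos x hx).le) (V x.fst)
    have h2 := inner_mulByL_self_nonneg S.p_reg.1 (fun x hx => (S.p_pos x hx).le) x.fst
    have h3 := hδ x.fst
    have h4 : S.κ ^ 2 * ‖x.snd‖ ^ 2 ≤ 2 * ‖h‖ ^ 2 + 2 * S.η ^ 2 * ‖x.fst‖ ^ 2 := by
      have e5 : (S.κ : ℂ) • x.snd = h - (S.η : ℂ) • x.fst := by rw [hh]; abel
      have h5 := norm_sub_le h ((S.η : ℂ) • x.fst)
      rw [← e5, norm_smul, norm_smul, Complex.norm_real, Complex.norm_real,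
        Real.norm_of_nonneg hη.le, Real.norm_of_nonneg hκ.le] at h5
      have h6 : 0 ≤ S.κ * ‖x.snd‖ := by positivity
      nlinarith [sq_nonneg (‖h‖ - S.η * ‖x.fst‖), pow_le_pow_left₀ h6 h5 2]
    have h7 : k * ‖x.snd‖ ^ 2 * S.κ ^ 2
        ≤ (l⁻¹ * ‖h‖ ^ 2) * S.κ ^ 2 + k * 2 * S.η ^ 2 * ‖x.fst‖ ^ 2 := by
      have h8 : k * 2 ≤ l⁻¹ * S.κ ^ 2 := by
        rw [inv_mul_eq_div, le_div_iff₀ hl]; linarith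
      nlinarith [mul_le_mul_of_nonneg_left h4 hk0, mul_le_mul_of_nonneg_right h8 (sq_nonneg ‖h‖)]
    have h9 : k * ‖x.fst‖ ^ 2 + k * ‖x.snd‖ ^ 2 ≤ 2 * c * ‖x.fst‖ ^ 2 + l⁻¹ * ‖h‖ ^ 2 := by
      refine le_of_mul_le_mul_right ?_ (show 0 < S.κ ^ 2 by positivity)
      nlinarith [mul_le_mul_of_nonneg_right hk2 (sq_nonneg ‖x.fst‖)]
    have h10 : 0 ≤ (l * S.τ + S.β) * ‖V x.snd‖ ^ 2 := by positivity
    have h11 := mul_nonneg hl.le h1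
    have h12 := mul_nonneg (inv_nonneg.2 hl.le) h2
    rw [e1, WithLp.prod_norm_sq_eq_of_L2, mul_add]
    linarith
  obtain ⟨x, hx, hxy⟩ := exists_of_coercive_on (K := K) B hk (fun x _ => hcoer x) (e.symm (f, g))
  refine ⟨x.fst, x.snd, hx.1, hx.2, fun a' b' ha' hb' => ?_⟩
  have hy : e.symm (a', b') ∈ K := ⟨ha', hb'⟩
  exact (hBi x (e.symm (a', b'))).symm.trans (hxy _ hy)

theorem exists_weak_solution (S : Data) {l : ℝ} (hl : 0 < l) (f g : L2 S.L) :
    ∃ a b : L2 S.L, inner ℂ (oneL2 S.L) a = 0 ∧ inner ℂ (oneL2 S.L) b = 0 ∧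
      ∀ a' b' : L2 S.L, inner ℂ (oneL2 S.L) a' = 0 → inner ℂ (oneL2 S.L) b' = 0 →
        (inner ℂ ((l : ℂ) • mulByL S.m S.m_reg.1 (volterra S.L a)) (volterra S.L a')
          + inner ℂ (((l : ℂ)⁻¹) • mulByL S.p S.p_reg.1 a + (2 : ℂ) • mulByL S.δ S.δ_reg.1 a
            + ((l : ℂ)⁻¹ * S.η) • ((S.η : ℂ) • a + (S.κ : ℂ) • b)) a' = inner ℂ f a') ∧
        (inner ℂ (((l * S.τ + S.β : ℝ) : ℂ) • volterra S.L b) (volterra S.L b')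
          + inner ℂ (((l : ℂ)⁻¹ * S.κ) • ((S.η : ℂ) • a + (S.κ : ℂ) • b)) b' = inner ℂ g b') := by
  obtain ⟨a, b, ha, hb, h⟩ := exists_combined_weak_solution S hl f g
  refine ⟨a, b, ha, hb, fun a' b' ha' hb' => ⟨?_, ?_⟩⟩
  · have h1 := h a' 0 ha' (inner_zero_right _)
    simpa only [map_zero, inner_zero_right, add_zero] using h1
  · have h1 := h 0 b' (inner_zero_right _) hb'
    simpa only [map_zero, inner_zero_right, add_zero, zero_add] using h1

/-- The first and third equations give `u = (w + F.u) / l` and `θ = (F.θ - κ b - η a) / l` with `a =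
w_x`, `b = q_x`. Substituted in the other two, they give the weak system of `exists_weak_solution`.
Conversely, its two equations say that the total stress and `κ θ` have the required weak
derivatives, which is also the regularity the domain asks for. -/
theorem operator_surjective (S : Data) {l : ℝ} (hl : 0 < l) (F : Phase S) :
    ∃ U : (operator S).domain, (l : ℂ) • (U : Phase S) - operator S U = F := by
  have hl0 : (l : ℂ) ≠ 0 := Complex.ofReal_ne_zero.2 hl.ne'
  have hτ0 : (S.τ : ℂ) ≠ 0 := Complex.ofReal_ne_zero.2 S.τ_pos.ne'
  have hκ0 : (S.κ : ℂ) ≠ 0 := Complex.ofReal_ne_zero.2 S.κ_pos.ne'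
  have hL := S.L_pos
  obtain ⟨a, b, ha, hb, hab⟩ := exists_weak_solution S hl
    (ContinuousLinearMap.adjoint (volterra S.L) (mulByL S.m S.m_reg.1 F.w)
      - (l : ℂ)⁻¹ • mulByL S.p S.p_reg.1 F.du + ((l : ℂ)⁻¹ * S.η) • F.θ)
    ((S.τ : ℂ) • ContinuousLinearMap.adjoint (volterra S.L) F.q + ((l : ℂ)⁻¹ * S.κ) • F.θ)
  set w := volterra S.L a with hw
  set q := volterra S.L b with hq
  have hwm : w ∈ H10 S.L := volterra_mem_H10 hL ha
  have hqm : q ∈ H10 S.L := volterra_mem_H10 hL hb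
  have hwx : weakDeriv w = a := weakDeriv_volterra hL a
  have hqx : weakDeriv q = b := weakDeriv_volterra hL b
  set θ : L2 S.L := (l : ℂ)⁻¹ • (F.θ - (S.κ : ℂ) • b - (S.η : ℂ) • a) with hθ
  set u : H10 S.L := (l : ℂ)⁻¹ • (⟨w, hwm⟩ + F.u) with hu
  set U : Phase S := Phase.mk u w θ q with hU
  have hdu : U.du = (l : ℂ)⁻¹ • (a + F.du) := by
    rw [hU, Phase.du_mk, hu, Submodule.coe_smul, Submodule.coe_add,
      weakDeriv_smul _ ((H1 _).add_mem hwm.1 F.u.2.1), weakDeriv_add hwm.1 F.u.2.1, hwx]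
    rfl
  have hσ : IsWeakDeriv S.L (totalStress U)
      ((l : ℂ) • mulByL S.m S.m_reg.1 w - mulByL S.m S.m_reg.1 F.w : L2 S.L) := by
    refine isWeakDeriv_of_forall_inner hL fun a' ha' => ?_
    have h := (hab a' 0 ha' (inner_zero_right _)).1
    simp only [inner_add_left, inner_sub_left, ContinuousLinearMap.adjoint_inner_left] at h
    have e : totalStress U = (((l : ℂ)⁻¹) • mulByL S.p S.p_reg.1 a + (2 : ℂ) • mulByL S.δ S.δ_reg.1 a
        + ((l : ℂ)⁻¹ * S.η) • ((S.η : ℂ) • a + (S.κ : ℂ) • b))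
        + (l : ℂ)⁻¹ • mulByL S.p S.p_reg.1 F.du - ((l : ℂ)⁻¹ * S.η) • F.θ := by
      rw [totalStress_eq, hdu, map_smul, map_add]
      show (l : ℂ)⁻¹ • (_ + _) + (2 : ℂ) • mulByL S.δ S.δ_reg.1 (weakDeriv w) - (S.η : ℂ) • θ = _
      rw [hwx, hθ]
      module
    simp only [e, inner_sub_left, inner_add_left]
    linear_combination h
  have hθd : IsWeakDeriv S.L θ
      ((S.κ : ℂ)⁻¹ • ((S.τ : ℂ) • F.q - ((l * S.τ + S.β : ℝ) : ℂ) • q) : L2 S.L) := by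
    have hs : IsWeakDeriv S.L ((S.κ : ℂ) • θ : L2 S.L)
        ((S.τ : ℂ) • F.q - ((l * S.τ + S.β : ℝ) : ℂ) • q : L2 S.L) := by
      refine isWeakDeriv_of_forall_inner hL fun b' hb' => ?_
      have h := (hab 0 b' (inner_zero_right _) hb').2
      simp only [inner_add_left, inner_smul_left,
        ContinuousLinearMap.adjoint_inner_left] at h
      have e : (S.κ : ℂ) • θ = ((l : ℂ)⁻¹ * S.κ) • F.θ
          - ((l : ℂ)⁻¹ * S.κ) • ((S.η : ℂ) • a + (S.κ : ℂ) • b) := by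
        rw [hθ]; module
      simp only [e, inner_sub_left, inner_add_left, inner_smul_left]
      linear_combination -h
    have := hs.smul (S.κ : ℂ)⁻¹
    rwa [inv_smul_smul₀ hκ0] at this
  have hmem : U ∈ (operator S).domain := by
    refine ⟨hwm, ?_, hθd.mem, hqm⟩
    -- The weak equation gives `H¹` regularity of the total stress; adding back `η θ ∈ H¹` gives
    -- that of `p u_x + 2 δ w_x`.
    have := (H1 S.L).add_mem hσ.mem ((H1 S.L).smul_mem (S.η : ℂ) hθd.mem)
    have e : stress S U = totalStress U + (S.η : ℂ) • θ := by
      rw [totalStress]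
      exact (sub_add_cancel _ _).symm
    rwa [e]
  refine ⟨⟨U, hmem⟩, ?_⟩
  have hsub : ∀ V W G : Phase S, V = G + W → V - W = G := fun V W G h => sub_eq_of_eq_add h
  refine hsub _ _ _ (Phase.ext' (Subtype.ext ?_) ?_ ?_ ?_)
  · have e : (l : ℂ) • u = ⟨w, hwm⟩ + F.u := by rw [hu, smul_inv_smul₀ hl0]
    have e' := congrArg (fun z : H10 S.L => (z : L2 S.L)) e
    exact e'.trans (add_comm _ _)
  · have hi := mulBy_inv_mulBy S.m_reg.1 S.m_pos (continuousOn_inv_m S)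
    have h1 : (operator S ⟨U, hmem⟩).w = (l : ℂ) • w - F.w := by
      have h2 := operator_w (⟨U, hmem⟩ : (operator S).domain)
      rw [hσ.weakDeriv_eq, ← map_smul, ← map_sub] at h2
      rw [← hi (operator S ⟨U, hmem⟩).w, ← hi ((l : ℂ) • w - F.w)]
      exact congrArg _ h2
    rw [Phase.add_w, h1, add_sub_cancel]
    rfl
  · rw [Phase.add_θ, operator_θ]
    show (l : ℂ) • θ = F.θ + (-((S.κ : ℂ) • weakDeriv q) - (S.η : ℂ) • weakDeriv w)
    rw [hwx, hqx, hθ, smul_inv_smul₀ hl0]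
    abel
  · have h1 := operator_q (⟨U, hmem⟩ : (operator S).domain)
    have h2 : weakDeriv (U : Phase S).θ = _ := hθd.weakDeriv_eq
    rw [h2, smul_inv_smul₀ hκ0] at h1
    have h3 : (S.τ : ℂ) • ((l : ℂ) • q) = (S.τ : ℂ) • (F.q + (operator S ⟨U, hmem⟩).q) := by
      rw [smul_add, h1]
      show _ = (S.τ : ℂ) • F.q + -((S.τ : ℂ) • F.q - _ + (S.β : ℂ) • q)
      push_cast
      module
    have h4 := congrArg ((S.τ : ℂ)⁻¹ • ·) h3
    simp only [inv_smul_smul₀ hτ0] at h4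
    exact h4

end Resolvent

end ThermoBeam

namespace ThermoBeam

variable {S : Data}

theorem operator_isMDissipative (S : Data) : DissipativeSemigroup.IsMDissipative (operator S) :=
  ⟨operator_dissipative, fun _ hl F => operator_surjective S hl F⟩

/-! ## The Lyapunov functional -/

section Lyapunov

theorem hasZeroMean_iff (U : Phase S) : HasZeroMean U ↔ inner ℂ (oneL2 S.L) U.θ = 0 := by
  rw [HasZeroMean, inner_oneL2]

/-- The operator of the multiplier `u` of the momentum equation. -/
noncomputable def displacementMultiplier (S : Data) : Phase S →L[ℂ] Phase S :=
  wEmb S ∘L volterra S.L ∘L duL S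

/-- The operator of the multiplier `∫₀ˣ θ` of the heat flux equation. -/
noncomputable def heatMultiplier (S : Data) : Phase S →L[ℂ] Phase S :=
  qEmb S ∘L volterra S.L ∘L θL S

theorem inner_displacementMultiplier (U V : Phase S) :
    inner ℂ U (displacementMultiplier S V) = inner ℂ (mulByL S.m S.m_reg.1 U.w) (V.u : L2 S.L) := by
  rw [V.u_eq_volterra, inner_mulByL_left]
  exact inner_wEmb U _

theorem inner_heatMultiplier (U V : Phase S) :
    inner ℂ U (heatMultiplier S V) = inner ℂ ((S.τ : ℂ) • U.q) (volterra S.L V.θ) := by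
  rw [inner_smul_left, Complex.conj_ofReal]
  exact inner_qEmb U _

/-- The momentum equation is tested with `u`, which vanishes at the ends, so the total stress is
paired with `-u_x`. The other term is the kinetic energy, as `u_t = w`. -/
theorem displacementMultiplier_deriv (U : (operator S).domain) :
    (inner ℂ (operator S U) (displacementMultiplier S U)).re
      + (inner ℂ (U : Phase S) (displacementMultiplier S (operator S U))).re
      = (inner ℂ (U : Phase S).w (mulByL S.m S.m_reg.1 (U : Phase S).w)).re
        - (inner ℂ (U : Phase S).du (mulByL S.p S.p_reg.1 (U : Phase S).du)).re
        - 2 * (inner ℂ (mulByL S.δ S.δ_reg.1 (weakDeriv (U : Phase S).w)) (U : Phase S).du).re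
        + S.η * (inner ℂ (U : Phase S).θ (U : Phase S).du).re := by
  rw [inner_displacementMultiplier, inner_displacementMultiplier, operator_w, operator_u,
    inner_weakDeriv_left S.L_pos (totalStress_mem U) (U : Phase S).u.2, inner_mulByL_left,
    totalStress_eq]
  rw [show (2 : ℂ) = ((2 : ℝ) : ℂ) by norm_num]
  simp only [Phase.du, inner_add_left, inner_sub_left, inner_smul_left, inner_mulByL_left S.p_reg.1,
    Complex.conj_ofReal, Complex.neg_re, Complex.add_re, Complex.sub_re, Complex.re_ofReal_mul]
  ring

/-- The flux equation is tested with `V θ`. Zero mean puts `V θ` in `H¹₀`, so `⟨θ_x, V θ⟩ = -‖θ‖²`;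
and `V θ_t = -κ q - η w` because `q` and `w` lie in `H¹₀`. The term `κ ‖θ‖²` has the wrong sign for
decay, so this multiplier enters the functional with a minus sign. -/
theorem heatMultiplier_deriv (U : (operator S).domain) (hU : HasZeroMean (U : Phase S)) :
    (inner ℂ (operator S U) (heatMultiplier S U)).re
      + (inner ℂ (U : Phase S) (heatMultiplier S (operator S U))).re
      = S.κ * ‖(U : Phase S).θ‖ ^ 2
        - S.β * (inner ℂ (U : Phase S).q (volterra S.L (U : Phase S).θ)).re
        - S.τ * S.κ * ‖(U : Phase S).q‖ ^ 2
        - S.τ * S.η * (inner ℂ (U : Phase S).q (U : Phase S).w).re := by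
  obtain ⟨hw, -, hθ, hq⟩ := U.2
  have h0 := (hasZeroMean_iff _).1 hU
  have e1 : volterra S.L (operator S U).θ
      = -((S.κ : ℂ) • (U : Phase S).q) - (S.η : ℂ) • (U : Phase S).w := by
    rw [operator_θ, map_sub, map_neg, map_smul, map_smul, ← (H10.eq_volterra S.L_pos hq).2,
      ← (H10.eq_volterra S.L_pos hw).2]
  rw [inner_heatMultiplier, inner_heatMultiplier, operator_q, e1]
  simp only [inner_add_left, inner_neg_left, inner_smul_left, inner_sub_right, inner_neg_right,
    inner_smul_right, Complex.conj_ofReal, inner_weakDeriv_left S.L_pos hθ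
    (volterra_mem_H10 S.L_pos h0), weakDeriv_volterra S.L_pos, Complex.neg_re, Complex.add_re,
    Complex.sub_re, Complex.re_ofReal_mul, re_inner_self]
  ring

/-- Poincaré's inequality. -/
theorem norm_w_le (U : (operator S).domain) :
    ‖(U : Phase S).w‖ ≤ ‖volterra S.L‖ * ‖weakDeriv (U : Phase S).w‖ := by
  conv_lhs => rw [(H10.eq_volterra S.L_pos U.2.1).2]
  exact (volterra S.L).le_opNorm _

theorem displacementMultiplier_deriv_le (U : (operator S).domain) {p : ℝ}
    (hp : ∀ f : L2 S.L, p * ‖f‖ ^ 2 ≤ (inner ℂ f (mulByL S.p S.p_reg.1 f)).re) :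
    (inner ℂ (operator S U) (displacementMultiplier S U)).re
      + (inner ℂ (U : Phase S) (displacementMultiplier S (operator S U))).re
      ≤ ‖mulByL S.m S.m_reg.1‖ * ‖volterra S.L‖ ^ 2 * ‖weakDeriv (U : Phase S).w‖ ^ 2
        - p * ‖(U : Phase S).du‖ ^ 2
        + 2 * ‖mulByL S.δ S.δ_reg.1‖ * (‖weakDeriv (U : Phase S).w‖ * ‖(U : Phase S).du‖)
        + S.η * (‖(U : Phase S).θ‖ * ‖(U : Phase S).du‖) := by
  rw [displacementMultiplier_deriv]
  have hwv := norm_w_le U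
  set wx := weakDeriv (U : Phase S).w with hwx
  have b1 : (inner ℂ (U : Phase S).w (mulByL S.m S.m_reg.1 (U : Phase S).w)).re
      ≤ ‖mulByL S.m S.m_reg.1‖ * ‖volterra S.L‖ ^ 2 * ‖wx‖ ^ 2 := by
    refine (inner_mulByL_self_le _ _).trans ?_
    rw [mul_assoc, ← mul_pow]
    gcongr
  have b2 : -(2 * (inner ℂ (mulByL S.δ S.δ_reg.1 wx) (U : Phase S).du).re)
      ≤ 2 * ‖mulByL S.δ S.δ_reg.1‖ * (‖wx‖ * ‖(U : Phase S).du‖) := by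
    have h1 := (Complex.abs_re_le_norm _).trans (norm_inner_le_norm (𝕜 := ℂ)
      (mulByL S.δ S.δ_reg.1 wx) (U : Phase S).du)
    have h2 := mul_le_mul_of_nonneg_right ((mulByL S.δ S.δ_reg.1).le_opNorm wx)
      (norm_nonneg (U : Phase S).du)
    linarith [neg_le_abs (inner ℂ (mulByL S.δ S.δ_reg.1 wx) (U : Phase S).du).re]
  have b3 : (inner ℂ (U : Phase S).θ (U : Phase S).du).re
      ≤ ‖(U : Phase S).θ‖ * ‖(U : Phase S).du‖ :=
    (Complex.re_le_norm _).trans (norm_inner_le_norm _ _)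
  have b6 := hp (U : Phase S).du
  have c1 := mul_le_mul_of_nonneg_left b3 S.η_pos.le
  linarith

theorem heatMultiplier_deriv_le (U : (operator S).domain) (hU : HasZeroMean (U : Phase S)) :
    -((inner ℂ (operator S U) (heatMultiplier S U)).re
      + (inner ℂ (U : Phase S) (heatMultiplier S (operator S U))).re)
      ≤ -(S.κ * ‖(U : Phase S).θ‖ ^ 2)
        + S.β * ‖volterra S.L‖ * (‖(U : Phase S).q‖ * ‖(U : Phase S).θ‖)
        + S.τ * S.κ * ‖(U : Phase S).q‖ ^ 2
        + S.τ * S.η * ‖volterra S.L‖ * (‖(U : Phase S).q‖ * ‖weakDeriv (U : Phase S).w‖) := by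
  rw [heatMultiplier_deriv U hU]
  have hwv := norm_w_le U
  have b4 : (inner ℂ (U : Phase S).q (volterra S.L (U : Phase S).θ)).re
      ≤ ‖volterra S.L‖ * (‖(U : Phase S).q‖ * ‖(U : Phase S).θ‖) := by
    refine (Complex.re_le_norm _).trans ((norm_inner_le_norm _ _).trans ?_)
    nlinarith [(volterra S.L).le_opNorm (U : Phase S).θ, norm_nonneg (U : Phase S).q]
  have b5 : (inner ℂ (U : Phase S).q (U : Phase S).w).re
      ≤ ‖volterra S.L‖ * (‖(U : Phase S).q‖ * ‖weakDeriv (U : Phase S).w‖) := by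
    refine (Complex.re_le_norm _).trans ((norm_inner_le_norm _ _).trans ?_)
    nlinarith [norm_nonneg (U : Phase S).q]
  have c2 := mul_le_mul_of_nonneg_left b4 S.β_pos.le
  have c3 := mul_le_mul_of_nonneg_left b5 (mul_pos S.τ_pos S.η_pos).le
  linarith

/-- Here `u, w, θ, q` stand for the norms of `u_x, w_x, θ, q`; `-4dw² - 2bq²` bounds the derivative
of the energy, and the brackets those of the two multiplier terms. The bound `R` keeps the weights
small enough for the functional to remain equivalent to the energy. -/
theorem exists_lyapunov_weights {d p k b R η : ℝ} (hd : 0 < d) (hp : 0 < p) (hk : 0 < k) (hb : 0 < b)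
    (hR : 0 < R) (hη : 0 < η) {x₁ x₂ x₃ x₄ x₅ : ℝ} (h₁ : 0 ≤ x₁)
    (h₄ : 0 ≤ x₄) (h₅ : 0 ≤ x₅) :
    ∃ ε > 0, ∃ M > 0, ∃ r > 0, ε ≤ R ∧ M ≤ R ∧ ∀ u w θ q : ℝ,
      -(4 * d * w ^ 2) - 2 * b * q ^ 2 + ε * (x₁ * w ^ 2 - p * u ^ 2 + x₂ * (w * u) + η * (θ * u))
        + M * (-(k * θ ^ 2) + x₃ * (q * θ) + x₄ * q ^ 2 + x₅ * (q * w))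
        ≤ -(r * (u ^ 2 + w ^ 2 + θ ^ 2 + q ^ 2)) := by
  -- `s` is the ratio `ε / M`. Completing the square in `η θ u` costs `ε η² / p` in `θ²`, which this
  -- choice makes `M k / 4`: of the available `M k`, a half is spent on `q θ` and a quarter here, so
  -- a quarter remains.
  set s := k * p / (4 * η ^ 2) with hs
  have hs0 : 0 < s := by positivity
  set C₁ := x₁ + x₂ ^ 2 / p with hC₁
  set C₃ := x₄ + x₃ ^ 2 / (2 * k) + x₅ / 2 with hC₃
  have hC₁0 : 0 ≤ C₁ := by positivity
  have hC₃0 : 0 ≤ C₃ := by positivity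
  -- `C₁` and `C₃` collect the coefficients of `w²` and `q²` produced by the multipliers. For small
  -- `M` they use up at most `3d` of `4d` and `b` of `2b`.
  obtain ⟨M, hM, hMR, hMsR, hMd, hMb⟩ : ∃ M > 0, M ≤ R ∧ M * s ≤ R ∧
      M * (s * C₁ + x₅ / 2) ≤ 3 * d ∧ M * C₃ ≤ b := by
    refine ⟨min (min R (R / s)) (min (3 * d / (s * C₁ + x₅ / 2 + 1)) (b / (C₃ + 1))), by positivity,
      ?_, ?_, ?_, ?_⟩
    · exact (min_le_left _ _).trans (min_le_left _ _)
    · exact (le_div_iff₀ hs0).1 ((min_le_left _ _).trans (min_le_right _ _))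
    · set M := min (min R (R / s)) (min (3 * d / (s * C₁ + x₅ / 2 + 1)) (b / (C₃ + 1)))
      have h0 : 0 ≤ M := by positivity
      have := (le_div_iff₀ (show 0 < s * C₁ + x₅ / 2 + 1 by positivity)).1
        (show M ≤ _ from (min_le_right _ _).trans (min_le_left _ _))
      nlinarith
    · set M := min (min R (R / s)) (min (3 * d / (s * C₁ + x₅ / 2 + 1)) (b / (C₃ + 1)))
      have h0 : 0 ≤ M := by positivity
      have := (le_div_iff₀ (show 0 < C₃ + 1 by positivity)).1
        (show M ≤ _ from (min_le_right _ _).trans (min_le_right _ _))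
      nlinarith
  refine ⟨M * s, by positivity, M, hM, min (min d b) (min (M * s * (p / 2)) (M * (k / 4))),
    by positivity, hMsR, hMR, fun u w θ q => ?_⟩
  set r := min (min d b) (min (M * s * (p / 2)) (M * (k / 4)))
  have r1 : r ≤ d := (min_le_left _ _).trans (min_le_left _ _)
  have r2 : r ≤ b := (min_le_left _ _).trans (min_le_right _ _)
  have r3 : r ≤ M * s * (p / 2) := (min_le_right _ _).trans (min_le_left _ _)
  have r4 : r ≤ M * (k / 4) := (min_le_right _ _).trans (min_le_right _ _)
  have i1 : x₂ * (w * u) ≤ p / 4 * u ^ 2 + x₂ ^ 2 / p * w ^ 2 := by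
    have : p / 4 * u ^ 2 + x₂ ^ 2 / p * w ^ 2 - x₂ * (w * u) = p * (u / 2 - x₂ / p * w) ^ 2 := by
      field_simp; ring
    have h : 0 ≤ p * (u / 2 - x₂ / p * w) ^ 2 := by positivity
    linarith
  have i2 : η * (θ * u) ≤ p / 4 * u ^ 2 + η ^ 2 / p * θ ^ 2 := by
    have : p / 4 * u ^ 2 + η ^ 2 / p * θ ^ 2 - η * (θ * u) = p * (u / 2 - η / p * θ) ^ 2 := by
      field_simp; ring
    have h : 0 ≤ p * (u / 2 - η / p * θ) ^ 2 := by positivity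
    linarith
  have i3 : x₃ * (q * θ) ≤ k / 2 * θ ^ 2 + x₃ ^ 2 / (2 * k) * q ^ 2 := by
    have : k / 2 * θ ^ 2 + x₃ ^ 2 / (2 * k) * q ^ 2 - x₃ * (q * θ)
        = k / 2 * (θ - x₃ / k * q) ^ 2 := by
      field_simp; ring
    have h : 0 ≤ k / 2 * (θ - x₃ / k * q) ^ 2 := by positivity
    linarith
  have i4 : x₅ * (q * w) ≤ x₅ / 2 * q ^ 2 + x₅ / 2 * w ^ 2 := by
    nlinarith [mul_nonneg h₅ (sq_nonneg (q - w))]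
  have i5 : s * (η ^ 2 / p) = k / 4 := by rw [hs]; field_simp
  have j1 := mul_le_mul_of_nonneg_left (add_le_add i1 i2) (mul_pos hM hs0).le
  have j2 := mul_le_mul_of_nonneg_left (add_le_add i3 i4) hM.le
  have j3 : M * s * (η ^ 2 / p * θ ^ 2) = M * (k / 4) * θ ^ 2 := by rw [← i5]; ring
  have k1 := mul_le_mul_of_nonneg_right r1 (sq_nonneg w)
  have k2 := mul_le_mul_of_nonneg_right r2 (sq_nonneg q)
  have k3 := mul_le_mul_of_nonneg_right r3 (sq_nonneg u)
  have k4 := mul_le_mul_of_nonneg_right r4 (sq_nonneg θ)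
  have k5 := mul_le_mul_of_nonneg_right hMd (sq_nonneg w)
  have k6 := mul_le_mul_of_nonneg_right hMb (sq_nonneg q)
  simp only [hC₁, hC₃] at k5 k6
  linarith

/-- The operator is `P = 1 + ε P₁ - M P₂`, a small perturbation of the energy by the two
multipliers. -/
theorem exists_lyapunov (S : Data) : ∃ P : Phase S →L[ℂ] Phase S, ∃ r > 0,
    (∀ U : Phase S, 1 / 2 * ‖U‖ ^ 2 ≤ (inner ℂ U (P U)).re) ∧
    (∀ U : Phase S, (inner ℂ U (P U)).re ≤ 3 / 2 * ‖U‖ ^ 2) ∧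
    ∀ U : (operator S).domain, HasZeroMean (U : Phase S) →
      (inner ℂ (operator S U) (P U)).re + (inner ℂ (U : Phase S) (P (operator S U))).re
        ≤ -(2 * r) * (inner ℂ (U : Phase S) (P U)).re := by
  obtain ⟨d, hd, hδ⟩ := exists_coercive_mulByL S.L_pos S.δ_reg.1 S.δ_pos
  obtain ⟨p, hp, hpc⟩ := exists_coercive_mulByL S.L_pos S.p_reg.1 S.p_pos
  obtain ⟨K, hK, hKn⟩ := exists_phase_norm_sq_le S
  have hη := S.η_pos
  have hκ := S.κ_pos
  have hτ := S.τ_pos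
  have hβ := S.β_pos
  set P₁ := displacementMultiplier S
  set P₂ := heatMultiplier S
  set v := ‖volterra S.L‖ with hv
  -- With `ε, M ≤ R` the perturbation changes the quadratic form by at most half of `‖U‖²`.
  set R := 1 / (2 * (‖P₁‖ + ‖P₂‖ + 1)) with hR
  have hv0 : 0 ≤ v := norm_nonneg _
  have hR0 : 0 < R := by positivity
  obtain ⟨ε, hε, M, hM, r, hr, hεR, hMR, hrate⟩ := exists_lyapunov_weights hd hp hκ hβ hR0 hη
    (x₁ := ‖mulByL S.m S.m_reg.1‖ * v ^ 2) (x₂ := 2 * ‖mulByL S.δ S.δ_reg.1‖) (x₃ := S.β * v)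
    (x₄ := S.τ * S.κ) (x₅ := S.τ * S.η * v) (by positivity) (by positivity) (by positivity)
  set P : Phase S →L[ℂ] Phase S := 1 + (ε : ℂ) • P₁ - (M : ℂ) • P₂ with hP
  have hPi : ∀ U V : Phase S, (inner ℂ U (P V)).re
      = (inner ℂ U V).re + ε * (inner ℂ U (P₁ V)).re - M * (inner ℂ U (P₂ V)).re := by
    intro U V
    have : P V = V + (ε : ℂ) • P₁ V - (M : ℂ) • P₂ V := rfl
    rw [this, inner_sub_right, inner_add_right, inner_smul_right, inner_smul_right, Complex.sub_re,
      Complex.add_re, Complex.re_ofReal_mul, Complex.re_ofReal_mul]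
  have hPb : ∀ U : Phase S, |(inner ℂ U (P U)).re - ‖U‖ ^ 2| ≤ 1 / 2 * ‖U‖ ^ 2 := by
    intro U
    have hb : ∀ Q : Phase S →L[ℂ] Phase S, |(inner ℂ U (Q U)).re| ≤ ‖Q‖ * ‖U‖ ^ 2 := fun Q => by
      refine (Complex.abs_re_le_norm _).trans ((norm_inner_le_norm _ _).trans ?_)
      nlinarith [Q.le_opNorm U, norm_nonneg U]
    have e : (inner ℂ U (P U)).re - ‖U‖ ^ 2
        = ε * (inner ℂ U (P₁ U)).re - M * (inner ℂ U (P₂ U)).re := by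
      rw [hPi, re_inner_self]; ring
    have h1 : ε * |(inner ℂ U (P₁ U)).re| ≤ R * (‖P₁‖ * ‖U‖ ^ 2) :=
      mul_le_mul hεR (hb P₁) (abs_nonneg _) hR0.le
    have h2 : M * |(inner ℂ U (P₂ U)).re| ≤ R * (‖P₂‖ * ‖U‖ ^ 2) :=
      mul_le_mul hMR (hb P₂) (abs_nonneg _) hR0.le
    have h3 : R * (‖P₁‖ + ‖P₂‖) ≤ 1 / 2 := by
      rw [hR, div_mul_eq_mul_div, div_le_iff₀ (by positivity)]
      linarith
    rw [e]
    refine (abs_sub _ _).trans ?_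
    rw [abs_mul, abs_mul, abs_of_pos hε, abs_of_pos hM]
    nlinarith [mul_le_mul_of_nonneg_right h3 (sq_nonneg ‖U‖)]
  have hlow : ∀ U : Phase S, 1 / 2 * ‖U‖ ^ 2 ≤ (inner ℂ U (P U)).re := fun U => by
    linarith [(abs_le.1 (hPb U)).1]
  have hupp : ∀ U : Phase S, (inner ℂ U (P U)).re ≤ 3 / 2 * ‖U‖ ^ 2 := fun U => by
    linarith [(abs_le.1 (hPb U)).2]
  -- The functional is at most `3/2 ‖U‖²`, and `‖U‖²` is at most `K (1 + v²)` times the sum of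
  -- squares in the dissipation. The factor `1 + v²` is the price of replacing `‖w‖` by `‖w_x‖`
  -- through Poincaré.
  refine ⟨P, r / (3 * (K * (1 + v ^ 2))), by positivity, hlow, hupp, fun U hU => ?_⟩
  have d1 := mul_le_mul_of_nonneg_left (displacementMultiplier_deriv_le U hpc) hε.le
  have d2 := mul_le_mul_of_nonneg_left (heatMultiplier_deriv_le U hU) hM.le
  have e3 := re_inner_operator U
  have b7 := hδ (weakDeriv (U : Phase S).w)
  have hwv := norm_w_le U
  have h1 := hrate ‖(U : Phase S).du‖ ‖weakDeriv (U : Phase S).w‖ ‖(U : Phase S).θ‖ ‖(U : Phase S).q‖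
  have h2 := hKn U
  have h4 := hupp (U : Phase S)
  rw [hPi (operator S U), hPi _ (operator S U), re_inner_comm (operator S U)]
  rw [← hv] at d1 d2 hwv
  generalize (inner ℂ (U : Phase S) (P U)).re = Q at h4 ⊢
  generalize ‖(U : Phase S)‖ = N at h2 h4
  generalize ‖(U : Phase S).du‖ = x at *
  generalize ‖weakDeriv (U : Phase S).w‖ = y at *
  generalize ‖(U : Phase S).θ‖ = z at *
  generalize ‖(U : Phase S).q‖ = q at *
  have h5 : N ^ 2 ≤ K * (1 + v ^ 2) * (x ^ 2 + y ^ 2 + z ^ 2 + q ^ 2) := by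
    refine h2.trans ?_
    rw [mul_assoc]
    refine mul_le_mul_of_nonneg_left ?_ hK.le
    have h3 := pow_le_pow_left₀ (norm_nonneg _) hwv 2
    rw [mul_pow] at h3
    have := mul_nonneg (sq_nonneg v) (sq_nonneg x)
    have := mul_nonneg (sq_nonneg v) (sq_nonneg z)
    have := mul_nonneg (sq_nonneg v) (sq_nonneg q)
    linarith [sq_nonneg y]
  have h6 : 2 * (r / (3 * (K * (1 + v ^ 2)))) * Q ≤ r * (x ^ 2 + y ^ 2 + z ^ 2 + q ^ 2) := by
    rw [← mul_div_assoc, div_mul_eq_mul_div, div_le_iff₀ (by positivity)]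
    have i1 := mul_le_mul_of_nonneg_left h4 hr.le
    have i2 := mul_le_mul_of_nonneg_left h5 hr.le
    linarith
  linarith

end Lyapunov

/-! ## The mean of the temperature -/

section Mean

/-- The integral of the temperature. -/
noncomputable def heat (S : Data) : Phase S →L[ℂ] ℂ := innerSL ℂ (oneL2 S.L) ∘L θL S

theorem heat_apply (U : Phase S) : heat S U = inner ℂ (oneL2 S.L) U.θ := rfl

theorem hasZeroMean_iff_heat (U : Phase S) : HasZeroMean U ↔ heat S U = 0 := hasZeroMean_iff U

/-- The temperature component of the range is a combination of derivatives of `H¹₀` functions, which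
have zero mean; so the total heat is conserved. -/
theorem heat_operator (U : (operator S).domain) : heat S (operator S U) = 0 := by
  obtain ⟨hw, -, -, hq⟩ := U.2
  rw [heat_apply, operator_θ, inner_sub_right, inner_neg_right, inner_smul_right, inner_smul_right,
    (H10.eq_volterra S.L_pos hw).1, (H10.eq_volterra S.L_pos hq).1]
  simp

theorem meanState_eq (U : Phase S) :
    meanState U = (θEmb S ∘L (ContinuousLinearMap.toSpanSingleton ℂ (oneL2 S.L)))
      ((S.L : ℂ)⁻¹ * heat S U) := by
  have : Lp.const 2 (volume.restrict (Ioo 0 S.L)) ((S.L : ℂ)⁻¹ * ∫ x in Ioo 0 S.L, U.θ x)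
      = ((S.L : ℂ)⁻¹ * heat S U) • oneL2 S.L := by
    refine Lp.ext ?_
    filter_upwards [Lp.coeFn_const 2 (volume.restrict (Ioo 0 S.L))
      ((S.L : ℂ)⁻¹ * ∫ x in Ioo 0 S.L, U.θ x), coeFn_oneL2 S.L,
      Lp.coeFn_smul ((S.L : ℂ)⁻¹ * heat S U) (oneL2 S.L)] with x h1 h2 h3
    rw [h1, h3, Pi.smul_apply, h2, smul_eq_mul, mul_one, heat_apply, inner_oneL2]
    rfl
  rw [meanState, this]
  rfl

theorem heat_meanState (U : Phase S) : heat S (meanState U) = heat S U := by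
  rw [meanState_eq, heat_apply]
  change inner ℂ (oneL2 S.L) (((S.L : ℂ)⁻¹ * heat S U) • oneL2 S.L) = _
  have h1 : inner ℂ (oneL2 S.L) (oneL2 S.L) = (S.L : ℂ) := by
    rw [inner_oneL2, integral_congr_ae (coeFn_oneL2 S.L)]
    simp [S.L_pos.le]
  have hL : (S.L : ℂ) ≠ 0 := Complex.ofReal_ne_zero.2 S.L_pos.ne'
  rw [inner_smul_right, h1]
  field_simp

theorem meanState_mem (U : Phase S) : meanState U ∈ (operator S).domain := by
  have h1 : (meanState U).w = 0 := rfl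
  have h2 : stress S (meanState U) = 0 := by
    change mulBy S.p S.p_reg.1 (weakDeriv (0 : L2 S.L)) + (2 : ℂ) • mulBy S.δ S.δ_reg.1
      (weakDeriv (0 : L2 S.L)) = 0
    rw [weakDeriv_zero, map_zero, map_zero, smul_zero, add_zero]
  refine ⟨(H10 S.L).zero_mem, ?_, ?_, (H10 S.L).zero_mem⟩
  · rw [h2]; exact (H1 S.L).zero_mem
  · rw [meanState_eq]
    exact (H1 S.L).smul_mem _ (isWeakDeriv_oneL2 S.L).mem

end Mean

end ThermoBeam

/-! ### Mean states as equilibria. -/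

namespace ThermoBeam

variable {S : Data}

theorem operator_meanState (U : Phase S) : operator S ⟨meanState U, meanState_mem U⟩ = 0 := by
  have hw : (meanState U).w = 0 := rfl
  have hq : (meanState U).q = 0 := rfl
  have hdu : (meanState U).du = 0 := Phase.du_mk_zero _ _ _
  have hθ : weakDeriv (meanState U).θ = 0 := by
    rw [meanState_eq]
    have := ((isWeakDeriv_oneL2 S.L).smul ((S.L : ℂ)⁻¹ * heat S U)).weakDeriv_eq
    rw [smul_zero] at this
    exact this
  have hσ : weakDeriv (totalStress (meanState U)) = 0 := by
    rw [totalStress_eq, hdu, hw, weakDeriv_zero, map_zero, map_zero, smul_zero, add_zero, zero_sub,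
      ← neg_smul, weakDeriv_smul _ (meanState_mem U).2.2.1, hθ, smul_zero]
  refine Phase.ext' (Subtype.ext rfl) ?_ ?_ ?_
  · show mulBy _ (continuousOn_inv_m S) (weakDeriv (totalStress (meanState U))) = 0
    rw [hσ, map_zero]
  · rw [operator_θ, hq, hw, weakDeriv_zero, smul_zero, smul_zero, neg_zero, sub_zero]
    rfl
  · show -((S.τ : ℂ)⁻¹ • ((S.κ : ℂ) • weakDeriv (meanState U).θ + (S.β : ℂ) • (meanState U).q)) = 0
    rw [hθ, hq, smul_zero, smul_zero, add_zero, smul_zero, neg_zero]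

theorem continuous_meanState : Continuous (meanState : Phase S → Phase S) := by
  rw [show (meanState : Phase S → Phase S) = _ from funext meanState_eq]
  exact (ContinuousLinearMap.continuous _).comp (continuous_const.mul (heat S).continuous)

theorem meanState_of_hasZeroMean {U : Phase S} (hU : HasZeroMean U) : meanState U = 0 := by
  rw [meanState_eq, (hasZeroMean_iff_heat U).1 hU, mul_zero, map_zero]

theorem hasZeroMean_sub_meanState (U : Phase S) : HasZeroMean (U - meanState U) := by
  rw [hasZeroMean_iff_heat, map_sub, heat_meanState, sub_self]

end ThermoBeam

namespace C0Semigroup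

/-- Elements of the kernel of the generator are at rest. -/
theorem IsGenerator.apply_eq_self {H : Type*} [NormedAddCommGroup H] [InnerProductSpace ℂ H]
    {T : C0Semigroup H} {A : H →ₗ.[ℂ] H} (hg : T.IsGenerator A) (hc : T.IsContraction)
    (x : A.domain) (hx : A x = 0) (t : ℝ≥0) : T.toFun t x = x := by
  have h := constant_of_has_deriv_right_zero (f := fun s : ℝ => T.toFun s.toNNReal (x : H))
    (a := 0) (b := t) (hc.continuous_orbit x).continuousOn (fun s hs => by
      have h := hg.hasDerivWithinAt x hs.1
      rwa [hx, _root_.map_zero] at h) t ⟨t.2, le_rfl⟩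
  simpa [T.map_zero] using h

end C0Semigroup

theorem theorem4p1 (S : ThermoBeam.Data) :
    ∃ T : C0Semigroup (ThermoBeam.Phase S),
      T.IsGenerator (ThermoBeam.operator S) ∧
      T.IsContraction ∧
      (∀ (t : ℝ≥0) (U : ThermoBeam.Phase S), ThermoBeam.HasZeroMean U →
        ThermoBeam.HasZeroMean (T.toFun t U)) ∧
      ∃ M r : ℝ, 0 < M ∧ 0 < r ∧
        (∀ (t : ℝ≥0) (U : ThermoBeam.Phase S), ThermoBeam.HasZeroMean U →
          ‖T.toFun t U‖ ≤ M * Real.exp (-r * t) * ‖U‖) ∧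
        (∀ (t : ℝ≥0) (U : ThermoBeam.Phase S),
          ‖T.toFun t U - ThermoBeam.meanState U‖
            ≤ M * Real.exp (-r * t) * ‖U - ThermoBeam.meanState U‖) := by
  have hA := ThermoBeam.operator_isMDissipative S
  obtain ⟨T, hg, hc⟩ := hA.exists_semigroup
  have hinv : ∀ (t : ℝ≥0) (U : ThermoBeam.Phase S), ThermoBeam.HasZeroMean U →
      ThermoBeam.HasZeroMean (T.toFun t U) := by
    intro t U hU
    rw [ThermoBeam.hasZeroMean_iff_heat] at hU ⊢
    rw [hg.conserved hc hA.dense (ThermoBeam.heat S) ThermoBeam.heat_operator, hU]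
  obtain ⟨P, r, hr, hlow, hupp, hdiss⟩ := ThermoBeam.exists_lyapunov S
  have hdec := hg.decay hc (K := {U | ThermoBeam.HasZeroMean U}) (fun U hU t => hinv t U hU) P
    (show (0 : ℝ) < 1 / 2 by norm_num) (fun U _ => hlow U) (fun U _ => hupp U) hdiss
  have hrest : ∀ t U, T.toFun t (ThermoBeam.meanState U) = ThermoBeam.meanState U := fun t U =>
    hg.apply_eq_self hc ⟨_, ThermoBeam.meanState_mem U⟩ (ThermoBeam.operator_meanState U) t
  have hall : ∀ (t : ℝ≥0) (U : ThermoBeam.Phase S),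
      ‖T.toFun t U - ThermoBeam.meanState U‖
        -- The constant comes from the bounds `1/2` and `3/2` on the Lyapunov functional.
        ≤ √((3 / 2) / (1 / 2)) * Real.exp (-r * t) * ‖U - ThermoBeam.meanState U‖ := by
    intro t U
    have hcl : IsClosed {U | ‖T.toFun t U - ThermoBeam.meanState U‖
        ≤ √((3 / 2) / (1 / 2)) * Real.exp (-r * t) * ‖U - ThermoBeam.meanState U‖} :=
      isClosed_le ((T.toFun t).continuous.sub ThermoBeam.continuous_meanState).norm
        (continuous_const.mul (continuous_id.sub ThermoBeam.continuous_meanState).norm)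
    -- The estimate is a closed condition on `U`, so the domain suffices. There `V - meanState V` is
    -- again in the domain and has zero mean; thus no separate density statement inside the
    -- zero-mean subspace is needed.
    refine hcl.closure_subset_iff.2 ?_ (hA.dense U)
    intro V hV
    have h := hdec t ⟨V - ThermoBeam.meanState V, Submodule.sub_mem _ hV (ThermoBeam.meanState_mem V)⟩
      (ThermoBeam.hasZeroMean_sub_meanState V)
    rw [map_sub, hrest] at h
    exact h
  refine ⟨T, hg, hc, hinv, √((3 / 2) / (1 / 2)), r, by positivity, hr, fun t U hU => ?_, hall⟩
  have h := hall t U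
  rwa [ThermoBeam.meanState_of_hasZeroMean hU, sub_zero, sub_zero] at h
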